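/- Let $S(x)=\int_{-\infty}^0 e^{-(x-\theta)^2/2}\,d\theta\Big/\int_0^\infty e^{-(x-\theta)^2/2}\,d\theta=1/\Phi(x)-1$, where $\Phi$ is the standard normal distribution function. For a dyadic bandwidth $h\in\{1/2,1/4,\dots,1/2^k,\dots\}$ put $n_h=1/(2h)$, $\mathcal G_h=\{h,3h,\dots,1-h\}$ (a set of $n_h$ points) and $$B_h(\xi)=\frac1{n_h}\sum_{t\in\mathcal G_h}S(\xi_{h,t}),$$ where the $\xi_{h,t}$, $t\in\mathcal G_h$, are i.i.d. standard normal random variables. Let $\varkappa_1,\varkappa_2,\dots$ be i.i.d. standard exponential random variables on some probability space, $\mathcal E_k=\sum_{l=1}^k\varkappa_l$, and $$\zeta^\circ=\sum_{k=1}^\infty\Bigl(\frac1{\mathcal E_k}-\frac1k\Bigr).$$ Then this series converges (absolutely) almost surely, and, on the probability space of the $\varkappa_l$, there are random variables $\varepsilon_h,a_h,b_h$ (one triple for each dyadic $h<1/2$, that is, for each $h$ with $n_h\ge2$) such that for every such $h$ $$B_h(\xi)-\log n_h+\gamma\ \stackrel{\mathcal D}{=}\ (1+a_h)\,\zeta^\circ+2\gamma-1+b_h\log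 n_h ,$$ where $\gamma$ is Euler's constant, $|a_h|\le K|\varepsilon_h|$ and $|b_h|\le K|\varepsilon_h|$ (so $a_h$ and $b_h$ are $O(\varepsilon_h)$), and for every integer $m\ge1$ the moment $\mathbf E\,\varepsilon_h^{2m}$ is finite with $$\bigl[\mathbf E\,\varepsilon_h^{2m}\bigr]^{1/(2m)}\le\frac{C_m}{\sqrt{n_h}} .$$ Here $K$ is an absolute constant and $C_m$ depends only on $m$. -/

import Mathlib

open MeasureTheory ProbabilityTheory

noncomputable section

/-- The improper Bayes statistic
`S(x) = ∫_{-∞}^0 exp(-(x-θ)²/2) dθ / ∫_0^∞ exp(-(x-θ)²/2) dθ` (which equals `1/Φ(x) - 1`). -/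
def bayesS (x : ℝ) : ℝ :=
  (∫ θ in Set.Iic (0 : ℝ), Real.exp (-(x - θ) ^ 2 / 2)) /
    (∫ θ in Set.Ici (0 : ℝ), Real.exp (-(x - θ) ^ 2 / 2))

/-- The dyadic bandwidths `{1/2, 1/4, …, 1/2^k, …}`. -/
def bandwidths : Set ℝ := {h | ∃ k : ℕ, 1 ≤ k ∧ h = 1 / 2 ^ k}

/-- The number of grid points `n_h = 1/(2h)`. -/
def gridSize (h : ℝ) : ℝ := 1 / (2 * h)

/-- The grid `{h, 3h, …, 1 - h}`, for a bandwidth `h`. -/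
def grid (h : ℝ) : Finset ℝ :=
  (Finset.range ⌊gridSize h⌋₊).image fun i : ℕ => (2 * (i : ℝ) + 1) * h

/-- The grid consists of the odd multiples of `h` that do not exceed `1 - h`. -/
theorem mem_grid_iff {h : ℝ} (hh : 0 < h) (t : ℝ) :
    t ∈ grid h ↔ ∃ i : ℕ, t = (2 * (i : ℝ) + 1) * h ∧ t ≤ 1 - h := by
  have key : ∀ i : ℕ, i < ⌊gridSize h⌋₊ ↔ (2 * (i : ℝ) + 1) * h ≤ 1 - h := by
    intro i
    rw [← Nat.succ_le_iff, Nat.le_floor_iff (by unfold gridSize; positivity), gridSize,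
      le_div_iff₀ (by positivity)]
    push_cast
    constructor <;> intro H <;> linarith
  simp only [grid, Finset.mem_image, Finset.mem_range, key]
  constructor
  · rintro ⟨i, hi, rfl⟩
    exact ⟨i, rfl, hi⟩
  · rintro ⟨i, rfl, hi⟩
    exact ⟨i, hi, rfl⟩

/-- For a dyadic bandwidth the grid has exactly `n_h` points. -/
theorem card_grid {h : ℝ} (hh : h ∈ bandwidths) : ((grid h).card : ℝ) = gridSize h := by
  obtain ⟨k, hk, rfl⟩ := hh
  obtain ⟨j, rfl⟩ := Nat.exists_eq_add_of_le' hk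
  have hs : gridSize (1 / 2 ^ (j + 1)) = ((2 ^ j : ℕ) : ℝ) := by
    rw [gridSize]; push_cast; field_simp; ring
  have hinj : Function.Injective fun i : ℕ => (2 * (i : ℝ) + 1) * (1 / 2 ^ (j + 1)) := by
    intro a b hab
    have h2 : (1 / 2 ^ (j + 1) : ℝ) ≠ 0 := by positivity
    have := mul_right_cancel₀ h2 hab
    have h3 : (a : ℝ) = b := by linarith
    exact_mod_cast h3
  rw [grid, Finset.card_image_of_injective _ hinj, Finset.card_range, hs, Nat.floor_natCast]

/-- The Bayes statistic `B_h(ξ) = (1/n_h) ∑_{t ∈ G_h} S(ξ_{h,t})`. -/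
def bayesB {Ω : Type*} (h : ℝ) (ξ : grid h → Ω → ℝ) (ω : Ω) : ℝ :=
  1 / gridSize h * ∑ t : grid h, bayesS (ξ t ω)

/-- The partial sum of the first `k` variables; `κ l` stands for the `(l+1)`-st variable. -/
def partialSum {Ω : Type*} (κ : ℕ → Ω → ℝ) (k : ℕ) (ω : Ω) : ℝ :=
  ∑ l ∈ Finset.range k, κ l ω

/-- The `(k+1)`-st term `1/E_{k+1} - 1/(k+1)` of the series that defines `ζ°`. -/
def zetaTerm {Ω : Type*} (κ : ℕ → Ω → ℝ) (k : ℕ) (ω : Ω) : ℝ :=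
  1 / partialSum κ (k + 1) ω - 1 / ((k : ℝ) + 1)

/-- `ζ° = ∑_{k ≥ 1} (1/E_k - 1/k)`. -/
def zetaCirc {Ω : Type*} (κ : ℕ → Ω → ℝ) (ω : Ω) : ℝ := ∑' k : ℕ, zetaTerm κ k ω

end

/-! Since `1 + S(x) = 1/Φ(x)`, the statistic is `(1/n) ∑ 1/U_i - 1` with `n = n_h` and independent
uniform `U_i`. The order statistics of the `U_i` suggest that `∑ 1/U_i` is distributed as `Z_n =
E_{n+1} ∑_{k≤n} 1/E_k`.

This is proved without ordering. Both sides have the law of the recursion `Z ↦ (Z + 1)/V`, where `V`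
has density `(n+1)vⁿ` and is independent of `Z` (`inverseSumLaw`). For the exponentials, `V =
E_{n+1}/E_{n+2}`, and the ratio of independent gamma variables is independent of their sum
(`map_partialSum_mul_inversePartialSum`). For the uniforms, with `G(v) = ∫_0^v e^{it/u} du`, the
recursion multiplies characteristic functions by `G(1)`, because `(n+1) Gⁿ G'` is an exact
derivative (`charFun_inverseSumLaw`).

The error `Δ = Z_n/n - log n - γ - ζ°` comes from `E_{n+1}/n - 1`, from `H_n - log n - γ`, and from
the tail of the series for `ζ°`. Put `ε = Δ/(|ζ°| + log n)`; then `Δ = aζ° + b log n` with `b = ε`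
and `a = ±ε`, the sign being that of `ζ°`.

Dividing by `|ζ°| + log n` is what makes all moments of `ε` finite: `1/E_k` has few moments, so the
tail of the series has few. If some `E_k` with `k > n` is below `k/2`, the tail is at most a
multiple of `|ζ°| + log n`, and a dominating series of powers of `|E_k - k|` is already at least
`1/8`. Otherwise that series bounds the tail directly (`abs_zetaCirc_sub_sum_le`). Its `L^{2m}` norm
is `O(n^{-1/2})` by exponential moments of `E_k - k`. -/

noncomputable section

open Set
open scoped ENNReal

/-! ### Erlang laws and the independence of ratio and sum -/

/-- The Erlang law with shape parameter `n + 1` and rate `1`. -/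
def erlang (n : ℕ) : Measure ℝ :=
  (volume.restrict (Ioi 0)).withDensity fun x => ENNReal.ofReal (x ^ n / n.factorial * Real.exp (-x))

/-- The law on `(0, 1)` with density `(n + 1) v ^ n`. -/
def powerLaw (n : ℕ) : Measure ℝ :=
  (volume.restrict (Ioo 0 1)).withDensity fun v => ENNReal.ofReal ((n + 1) * v ^ n)

instance (n : ℕ) : SFinite (erlang n) := by unfold erlang; infer_instance

instance (n : ℕ) : SFinite (powerLaw n) := by unfold powerLaw; infer_instance

theorem lintegral_erlang (n : ℕ) {f : ℝ → ℝ≥0∞} (hf : Measurable f) :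
    ∫⁻ x, f x ∂erlang n =
      ∫⁻ x in Ioi 0, ENNReal.ofReal (x ^ n / n.factorial * Real.exp (-x)) * f x := by
  rw [erlang, lintegral_withDensity_eq_lintegral_mul _ (by fun_prop) hf]
  rfl

theorem lintegral_powerLaw (n : ℕ) {f : ℝ → ℝ≥0∞} (hf : Measurable f) :
    ∫⁻ v, f v ∂powerLaw n = ∫⁻ v in Ioo 0 1, ENNReal.ofReal ((n + 1) * v ^ n) * f v := by
  rw [powerLaw, lintegral_withDensity_eq_lintegral_mul _ (by fun_prop) hf]
  rfl

theorem expMeasure_one_eq_erlang : expMeasure 1 = erlang 0 := by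
  rw [expMeasure, gammaMeasure, erlang, ← withDensity_indicator measurableSet_Ioi]
  refine withDensity_congr_ae ?_
  filter_upwards [compl_mem_ae_iff.2 (measure_singleton (0 : ℝ))] with x hx
  have hx : x ≠ 0 := hx
  rcases lt_or_gt_of_ne hx with h | h
  · rw [gammaPDF_of_neg h, indicator_of_notMem (by simpa using h.le)]
  · rw [gammaPDF_of_nonneg h.le, indicator_of_mem (by simpa using h)]
    simp

theorem ae_pos_erlang (n : ℕ) : ∀ᵐ x ∂erlang n, 0 < x :=
  (withDensity_absolutelyContinuous _ _).ae_le (ae_restrict_mem measurableSet_Ioi)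

theorem setLIntegral_Ioi_zero_add (x : ℝ) (g : ℝ → ℝ≥0∞) :
    ∫⁻ y in Ioi 0, g (x + y) = ∫⁻ s in Ioi x, g s := by
  have := (measurePreserving_add_left (volume : Measure ℝ) x).setLIntegral_comp_preimage_emb
    (measurableEmbedding_addLeft x) g (Ioi x)
  rw [← this]
  congr 2
  ext y
  simp

theorem setLIntegral_Ioo_zero_eq_mul {s : ℝ} (hs : 0 < s) (g : ℝ → ℝ≥0∞) :
    ∫⁻ x in Ioo 0 s, g x = ENNReal.ofReal s * ∫⁻ v in Ioo 0 1, g (s * v) := by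
  have himg : (fun v : ℝ => s * v) '' Ioo 0 1 = Ioo 0 s := by
    rw [image_mul_left_Ioo hs]; simp
  have := lintegral_image_eq_lintegral_abs_deriv_mul (s := Ioo (0 : ℝ) 1) (f := fun v => s * v)
    (f' := fun _ => s) measurableSet_Ioo
    (fun v _ => by simpa using ((hasDerivAt_id v).const_mul s).hasDerivWithinAt)
    (fun a _ b _ h => mul_left_cancel₀ hs.ne' h) g
  rw [himg] at this
  rw [this, abs_of_pos hs, lintegral_const_mul']
  exact ENNReal.ofReal_ne_top

/-- For independent Erlang and exponential variables `x`, `y`, the ratio `x / (x + y)` and the sum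
`x + y` are independent, with a power law and an Erlang law. -/
theorem lintegral_erlang_ratio_sum (n : ℕ) {F : ℝ → ℝ → ℝ≥0∞}
    (hF : Measurable (Function.uncurry F)) :
    ∫⁻ x, ∫⁻ y, F (x / (x + y)) (x + y) ∂erlang 0 ∂erlang n =
      ∫⁻ s, ∫⁻ v, F v s ∂powerLaw n ∂erlang (n + 1) := by
  have hm1 : Measurable (Function.uncurry fun x y => F (x / (x + y)) (x + y)) :=
    hF.comp (f := fun p : ℝ × ℝ => (p.1 / (p.1 + p.2), p.1 + p.2)) (by fun_prop)
  have hm2 : Measurable (Function.uncurry fun s v => F v s) :=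
    hF.comp measurable_swap
  have hm3 : Measurable (Function.uncurry fun x s => F (x / s) s) :=
    hF.comp (f := fun p : ℝ × ℝ => (p.1 / p.2, p.2)) (by fun_prop)
  rw [lintegral_erlang n hm1.lintegral_prod_right, lintegral_erlang (n + 1) hm2.lintegral_prod_right]
  -- The integrand in the coordinates `(x, s) = (x, x + y)`, cut to `x < s`. Integrating in `s`
  -- first gives the left side. Integrating in `x = sv` first gives the right side, the Jacobian `s`
  -- raising the Erlang shape by one.
  set G : ℝ → ℝ → ℝ≥0∞ := fun x s =>
    (Ioi (0 : ℝ)).indicator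
      (fun r => (ENNReal.ofReal (x ^ n / n.factorial * Real.exp (-s)) * F (x / s) s)) (s - x) with hG
  have hGm : Measurable (Function.uncurry G) := by
    have : Function.uncurry G = {p : ℝ × ℝ | p.1 < p.2}.indicator
        fun p => ENNReal.ofReal (p.1 ^ n / n.factorial * Real.exp (-p.2)) * F (p.1 / p.2) p.2 := by
      ext ⟨x, s⟩
      simp [hG, indicator, Function.uncurry]
    rw [this]
    refine Measurable.indicator (Measurable.mul (by fun_prop) hm3)
      (measurableSet_lt measurable_fst measurable_snd)
  have h1 : ∀ x ∈ Ioi (0 : ℝ), ENNReal.ofReal (x ^ n / n.factorial * Real.exp (-x)) *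
      ∫⁻ y, F (x / (x + y)) (x + y) ∂erlang 0 = ∫⁻ s in Ioi 0, G x s := by
    intro x hx
    have hx : 0 < x := hx
    rw [lintegral_erlang 0 (f := fun y => F (x / (x + y)) (x + y))
      (hm1.comp measurable_prodMk_left), ← lintegral_const_mul' _ _ (by simp)]
    have e1 : ∫⁻ s in Ioi 0, G x s =
        ∫⁻ s in Ioi x, ENNReal.ofReal (x ^ n / n.factorial * Real.exp (-s)) * F (x / s) s := by
      rw [← lintegral_indicator measurableSet_Ioi, ← lintegral_indicator measurableSet_Ioi]
      congr 1
      ext s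
      simp only [hG, indicator, mem_Ioi, sub_pos]
      split_ifs <;> first | rfl | (exfalso; linarith)
    rw [e1, ← setLIntegral_Ioi_zero_add x]
    refine lintegral_congr fun y => ?_
    rw [← mul_assoc, ← ENNReal.ofReal_mul (by positivity)]
    congr 2
    rw [neg_add, Real.exp_add]; simp; ring
  have h2 : ∀ s ∈ Ioi (0 : ℝ), ENNReal.ofReal (s ^ (n + 1) / (n + 1).factorial * Real.exp (-s)) *
      ∫⁻ v, F v s ∂powerLaw n = ∫⁻ x in Ioi 0, G x s := by
    intro s hs
    have hs : 0 < s := hs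
    have e1 : ∫⁻ x in Ioi 0, G x s =
        ∫⁻ x in Ioo 0 s, ENNReal.ofReal (x ^ n / n.factorial * Real.exp (-s)) * F (x / s) s := by
      rw [← lintegral_indicator measurableSet_Ioi, ← lintegral_indicator measurableSet_Ioo]
      congr 1
      ext x
      simp only [hG, indicator, mem_Ioi, mem_Ioo, sub_pos]
      split_ifs <;> first | rfl | (exfalso; grind)
    rw [e1, setLIntegral_Ioo_zero_eq_mul hs, lintegral_powerLaw n (f := fun v => F v s)
      (hm2.comp measurable_prodMk_left),
      ← lintegral_const_mul' _ _ (by simp), ← lintegral_const_mul' _ _ (by simp)]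
    refine setLIntegral_congr_fun measurableSet_Ioo fun v hv => ?_
    have hv : 0 < v := hv.1
    rw [← mul_assoc, ← mul_assoc, ← ENNReal.ofReal_mul (by positivity),
      ← ENNReal.ofReal_mul hs.le, mul_div_cancel_left₀ _ hs.ne']
    congr 2
    rw [Nat.factorial_succ]; push_cast
    field_simp
    ring
  rw [setLIntegral_congr_fun measurableSet_Ioi h1, setLIntegral_congr_fun measurableSet_Ioi h2]
  exact lintegral_lintegral_swap hGm.aemeasurable

/-! ### The recursive law, realized by exponential partial sums -/

/-- The law of a sum of `n` independent inverses of uniform variables, built recursively. -/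
def inverseSumLaw : ℕ → Measure ℝ
  | 0 => Measure.dirac 0
  | n + 1 => ((inverseSumLaw n).prod (powerLaw n)).map fun p => (p.1 + 1) / p.2

instance (n : ℕ) : IsProbabilityMeasure (powerLaw n) := by
  constructor
  have := lintegral_powerLaw n (f := fun _ => 1) measurable_const
  rw [lintegral_one] at this
  rw [this]
  simp only [mul_one]
  rw [← ofReal_integral_eq_lintegral_ofReal, ← integral_Ioc_eq_integral_Ioo,
    ← intervalIntegral.integral_of_le zero_le_one]
  · simp [integral_pow]
    field_simp
  · exact (Continuous.integrableOn_Icc (by fun_prop)).mono_set Ioo_subset_Icc_self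
  · filter_upwards [ae_restrict_mem measurableSet_Ioo] with v hv
    have := hv.1
    positivity

instance inverseSumLaw.instIsProbabilityMeasure (n : ℕ) :
    IsProbabilityMeasure (inverseSumLaw n) := by
  induction n with
  | zero => rw [inverseSumLaw]; infer_instance
  | succ n ih =>
    rw [inverseSumLaw]
    exact Measure.isProbabilityMeasure_map (by fun_prop)

/-- The induction step for the exponentials: a further exponential variable updates `Z` and the
running sum and leaves them independent. -/
theorem map_prod_erlang (n : ℕ) :
    (((inverseSumLaw n).prod (erlang n)).prod (erlang 0)).map
        (fun p => ((p.1.1 + 1) / (p.1.2 / (p.1.2 + p.2)), p.1.2 + p.2)) =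
      (inverseSumLaw (n + 1)).prod (erlang (n + 1)) := by
  refine Measure.ext_of_lintegral _ fun f hf => ?_
  rw [lintegral_map hf (by fun_prop), lintegral_prod _ (by fun_prop),
    lintegral_prod _ (by fun_prop)]
  have h (z : ℝ) := lintegral_erlang_ratio_sum n (F := fun v s => f ((z + 1) / v, s))
    (hf.comp (f := fun p : ℝ × ℝ => ((z + 1) / p.1, p.2)) (by fun_prop))
  simp only [h]
  rw [lintegral_lintegral_swap, lintegral_prod_symm _ hf.aemeasurable]
  · refine lintegral_congr fun s => ?_
    rw [inverseSumLaw, lintegral_map (by fun_prop) (by fun_prop), lintegral_prod _ (by fun_prop)]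
  · have : Measurable fun p : (ℝ × ℝ) × ℝ => f ((p.1.1 + 1) / p.2, p.1.2) := by fun_prop
    exact this.lintegral_prod_right.aemeasurable

/-- The sum of the inverses of the first `n` partial sums. -/
def inversePartialSum {Ω : Type*} (κ : ℕ → Ω → ℝ) (n : ℕ) (ω : Ω) : ℝ :=
  ∑ k ∈ Finset.range n, 1 / partialSum κ (k + 1) ω

theorem partialSum_congr {Ω Ω' : Type*} {κ : ℕ → Ω → ℝ} {κ' : ℕ → Ω' → ℝ} {ω : Ω}
    {ω' : Ω'} {n : ℕ} (h : ∀ l < n, κ l ω = κ' l ω') : partialSum κ n ω = partialSum κ' n ω' :=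
  Finset.sum_congr rfl fun l hl => h l (Finset.mem_range.1 hl)

theorem inversePartialSum_congr {Ω Ω' : Type*} {κ : ℕ → Ω → ℝ} {κ' : ℕ → Ω' → ℝ} {ω : Ω}
    {ω' : Ω'} {n : ℕ} (h : ∀ l < n, κ l ω = κ' l ω') : inversePartialSum κ n ω = inversePartialSum κ' n ω' :=
  Finset.sum_congr rfl fun k hk => by
    rw [partialSum_congr fun l hl => h l (hl.trans_le (Finset.mem_range.1 hk))]

/-- Total mass is carried from shape to shape by `map_prod_erlang`, starting from the exponential
law; no Gamma integral is evaluated. -/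
instance erlang.instIsProbabilityMeasure (n : ℕ) : IsProbabilityMeasure (erlang n) := by
  have h0 : IsProbabilityMeasure (erlang 0) := by
    rw [← expMeasure_one_eq_erlang]
    exact isProbabilityMeasure_expMeasure one_pos
  induction n with
  | zero => exact h0
  | succ n _ =>
    have h := map_prod_erlang n
    have h2 : IsProbabilityMeasure ((inverseSumLaw (n + 1)).prod (erlang (n + 1))) := by
      rw [← h]
      exact Measure.isProbabilityMeasure_map (by fun_prop)
    have h3 := h2.measure_univ
    rw [Measure.prod_apply MeasurableSet.univ] at h3
    exact ⟨by simpa using h3⟩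

section Exponential

variable {Ω : Type*} [MeasurableSpace Ω] {P : Measure Ω} {κ : ℕ → Ω → ℝ}

theorem aemeasurable_partialSum (hκ : ∀ l, AEMeasurable (κ l) P) (n : ℕ) :
    AEMeasurable (partialSum κ n) P := by
  unfold partialSum; fun_prop

theorem aemeasurable_inversePartialSum (hκ : ∀ l, AEMeasurable (κ l) P) (n : ℕ) :
    AEMeasurable (inversePartialSum κ n) P := by
  have := aemeasurable_partialSum hκ
  unfold inversePartialSum; fun_prop

theorem indepFun_partialSum (hκ : ∀ l, AEMeasurable (κ l) P) (hind : iIndepFun κ P) (n : ℕ) :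
    IndepFun (fun ω => (partialSum κ (n + 1) ω * inversePartialSum κ n ω, partialSum κ (n + 1) ω))
      (κ (n + 1)) P := by
  -- The coordinate process on the first `n + 1` indices, extended by zero, exhibits the pair as a
  -- measurable function of those variables alone.
  set κ' : ℕ → (Finset.range (n + 1) → ℝ) → ℝ :=
    fun l p => if h : l ∈ Finset.range (n + 1) then p ⟨l, h⟩ else 0 with hκ'
  have hm : ∀ l, Measurable (κ' l) := by
    intro l
    simp only [hκ']
    split_ifs with h
    · exact measurable_pi_apply _
    · exact measurable_const
  have hpm : ∀ l, Measurable (partialSum κ' l) := fun l => by unfold partialSum; fun_prop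
  have him : ∀ l, Measurable (inversePartialSum κ' l) := fun l => by
    unfold inversePartialSum; fun_prop
  have h := hind.indepFun_finset₀ (Finset.range (n + 1)) {n + 1} (by simp) hκ
  have hψ : Measurable fun p : ({n + 1} : Finset ℕ) → ℝ => p ⟨n + 1, by simp⟩ :=
    measurable_pi_apply _
  have h2 := h.comp
    (φ := fun p => (partialSum κ' (n + 1) p * inversePartialSum κ' n p, partialSum κ' (n + 1) p))
    (ψ := fun p : ({n + 1} : Finset ℕ) → ℝ => p ⟨n + 1, by simp⟩)
    (by fun_prop) hψ
  have hk : ∀ ω : Ω, ∀ l < n + 1,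
      κ' l (fun i : Finset.range (n + 1) => κ i ω) = κ l ω := fun ω l hl => by
    simp [hκ', Nat.lt_succ_iff.1 hl]
  convert! h2 using 1
  ext ω : 1
  simp only [Function.comp_apply]
  rw [partialSum_congr (hk ω), inversePartialSum_congr fun l hl => hk ω l (by omega)]

/-- With `I_n = ∑_{k≤n} 1/E_k`, one has `E_{n+2} I_{n+1} = (E_{n+1} I_n + 1)/(E_{n+1}/E_{n+2})`. The
joint law with `E_{n+1}` is needed for the induction, since the ratio involves it. -/
theorem map_partialSum_mul_inversePartialSum [IsProbabilityMeasure P]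
    (hκ : ∀ l, HasLaw (κ l) (expMeasure 1) P) (hind : iIndepFun κ P) (n : ℕ) :
    P.map (fun ω => (partialSum κ (n + 1) ω * inversePartialSum κ n ω, partialSum κ (n + 1) ω)) =
      (inverseSumLaw n).prod (erlang n) := by
  have hκm := fun l => (hκ l).aemeasurable
  induction n with
  | zero =>
    have h0 : (fun ω => (partialSum κ (0 + 1) ω * inversePartialSum κ 0 ω,
        partialSum κ (0 + 1) ω)) = fun ω => Prod.mk (0 : ℝ) (κ 0 ω) := by
      ext ω <;> simp [inversePartialSum, partialSum]
    rw [h0, inverseSumLaw, Measure.dirac_prod, ← expMeasure_one_eq_erlang, ← (hκ 0).map_eq,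
      AEMeasurable.map_map_of_aemeasurable (by fun_prop) (hκm 0)]
    rfl
  | succ n ih =>
    have hp := aemeasurable_partialSum hκm
    have hi := aemeasurable_inversePartialSum hκm
    have hjoint := (indepFun_iff_map_prod_eq_prod_map_map (by fun_prop) (hκm (n + 1))).1
      (indepFun_partialSum hκm hind n)
    rw [ih, (hκ (n + 1)).map_eq, expMeasure_one_eq_erlang] at hjoint
    rw [← map_prod_erlang, ← hjoint, AEMeasurable.map_map_of_aemeasurable (by fun_prop) (by fun_prop)]
    refine Measure.map_congr ?_
    have hpos : ∀ᵐ ω ∂P, 0 < partialSum κ (n + 1) ω := by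
      have h1 : P.map (partialSum κ (n + 1)) =
          ((inverseSumLaw n).prod (erlang n)).map Prod.snd := by
        rw [← ih, AEMeasurable.map_map_of_aemeasurable (by fun_prop) (by fun_prop)]
        rfl
      refine ae_of_ae_map (hp _) ?_
      rw [h1, ← Measure.snd, Measure.snd_prod]
      exact ae_pos_erlang n
    filter_upwards [hpos] with ω hω
    have e1 : partialSum κ (n + 1 + 1) ω = partialSum κ (n + 1) ω + κ (n + 1) ω :=
      Finset.sum_range_succ _ _
    have e2 : inversePartialSum κ (n + 1) ω =
        inversePartialSum κ n ω + 1 / partialSum κ (n + 1) ω := Finset.sum_range_succ _ _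
    simp only [Function.comp_apply, e1, e2, Prod.mk.injEq, and_true]
    rw [div_div_eq_mul_div]
    field_simp

theorem ae_partialSum_pos [IsProbabilityMeasure P]
    (hκ : ∀ l, HasLaw (κ l) (expMeasure 1) P) : ∀ᵐ ω ∂P, ∀ n, 0 < partialSum κ (n + 1) ω := by
  have h : ∀ᵐ ω ∂P, ∀ l, 0 < κ l ω := by
    refine ae_all_iff.2 fun l => ae_of_ae_map (hκ l).aemeasurable ?_
    rw [(hκ l).map_eq, expMeasure_one_eq_erlang]
    exact ae_pos_erlang 0
  filter_upwards [h] with ω hω n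
  exact Finset.sum_pos (fun l _ => hω l) (by simp)

theorem hasLaw_partialSum_mul_inversePartialSum [IsProbabilityMeasure P]
    (hκ : ∀ l, HasLaw (κ l) (expMeasure 1) P) (hind : iIndepFun κ P) (n : ℕ) :
    HasLaw (fun ω => partialSum κ (n + 1) ω * inversePartialSum κ n ω) (inverseSumLaw n) P := by
  have hκm := fun l => (hκ l).aemeasurable
  have hp := aemeasurable_partialSum hκm
  have hi := aemeasurable_inversePartialSum hκm
  refine ⟨by fun_prop, ?_⟩
  have h := congrArg Measure.fst (map_partialSum_mul_inversePartialSum hκ hind n)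
  rw [Measure.fst_prod, Measure.fst,
    AEMeasurable.map_map_of_aemeasurable (by fun_prop) (by fun_prop)] at h
  exact h

end Exponential

/-! ### Characteristic functions of sums of inverse uniforms -/

/-- The integrand of the characteristic function of the inverse of a uniform variable. -/
def inverseUniformChar (t u : ℝ) : ℂ := Complex.exp (t / u * Complex.I)

theorem norm_inverseUniformChar (t u : ℝ) : ‖inverseUniformChar t u‖ = 1 := by
  rw [inverseUniformChar, ← Complex.ofReal_div, Complex.norm_exp_ofReal_mul_I]

@[fun_prop]
theorem measurable_inverseUniformChar (t : ℝ) : Measurable (inverseUniformChar t) := by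
  unfold inverseUniformChar; fun_prop

theorem intervalIntegrable_inverseUniformChar (t a b : ℝ) :
    IntervalIntegrable (inverseUniformChar t) volume a b :=
  (intervalIntegrable_const (c := (1 : ℝ))).mono_fun
    (measurable_inverseUniformChar t).aestronglyMeasurable
    (Filter.Eventually.of_forall fun u => by simp [norm_inverseUniformChar])

/-- The characteristic function of the inverse of a uniform variable. -/
def inverseUniformCharFun (t : ℝ) : ℂ := ∫ u in (0 : ℝ)..1, inverseUniformChar t u

theorem mul_inverseUniformCharFun_div {t v : ℝ} (hv : 0 < v) :
    (v : ℂ) * inverseUniformCharFun (t / v) = ∫ u in (0 : ℝ)..v, inverseUniformChar t u := by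
  have h := intervalIntegral.integral_comp_mul_left (a := 0) (b := 1) (inverseUniformChar t) hv.ne'
  have h2 : inverseUniformCharFun (t / v) = ∫ u in (0 : ℝ)..1, inverseUniformChar t (v * u) := by
    unfold inverseUniformCharFun inverseUniformChar
    congr 1
    ext u
    congr 2
    push_cast
    rw [div_div]
  rw [h2, h, mul_zero, mul_one, Complex.real_smul, ← mul_assoc, ← Complex.ofReal_mul,
    mul_inv_cancel₀ hv.ne', Complex.ofReal_one, one_mul]

/-- The integrand is the derivative of the `(n+1)`-st power of the primitive. It may oscillate at
`0`, so differentiability is used only inside the interval, with continuity of the primitive at the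
endpoints. -/
theorem integral_pow_mul_inverseUniformChar (n : ℕ) (t : ℝ) :
    ∫ v in (0 : ℝ)..1, ((n + 1 : ℕ) : ℂ) * (∫ u in (0 : ℝ)..v, inverseUniformChar t u) ^ n *
      inverseUniformChar t v = inverseUniformCharFun t ^ (n + 1) := by
  have hcont : Continuous fun v => ∫ u in (0 : ℝ)..v, inverseUniformChar t u :=
    intervalIntegral.continuous_primitive (intervalIntegrable_inverseUniformChar t) 0
  rw [intervalIntegral.integral_eq_sub_of_hasDerivAt_of_le zero_le_one
    (f := fun v => (∫ u in (0 : ℝ)..v, inverseUniformChar t u) ^ (n + 1))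
    (hcont.pow _).continuousOn]
  · simp [inverseUniformCharFun]
  · intro v hv
    have hv0 : (v : ℂ) ≠ 0 := Complex.ofReal_ne_zero.2 hv.1.ne'
    have hc : ContinuousAt (inverseUniformChar t) v := by
      unfold inverseUniformChar; fun_prop (disch := assumption)
    have := (intervalIntegral.integral_hasDerivAt_right
      (intervalIntegrable_inverseUniformChar t 0 v)
      (measurable_inverseUniformChar t).stronglyMeasurable.stronglyMeasurableAtFilter hc).pow (n + 1)
    exact this
  · exact (intervalIntegrable_inverseUniformChar t 0 1).continuousOn_mul (by fun_prop)

theorem integral_powerLaw (n : ℕ) (f : ℝ → ℂ) :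
    ∫ v, f v ∂powerLaw n = ∫ v in (0 : ℝ)..1, ((n + 1 : ℕ) : ℂ) * (v : ℂ) ^ n * f v := by
  rw [powerLaw, integral_withDensity_eq_integral_toReal_smul (by fun_prop) (by simp),
    intervalIntegral.integral_of_le zero_le_one, integral_Ioc_eq_integral_Ioo]
  refine setIntegral_congr_fun measurableSet_Ioo fun v hv => ?_
  have : 0 ≤ v := hv.1.le
  rw [ENNReal.toReal_ofReal (by positivity), Complex.real_smul]
  push_cast
  rfl

/-- Conditioning on `V = v` gives `e^{it/v} φ(t/v)ⁿ`, where `φ` is the characteristic function of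
`1/U`; the weight `vⁿ` turns `φ(t/v)ⁿ` into the `n`-th power of a primitive. -/
theorem charFun_inverseSumLaw (n : ℕ) (t : ℝ) :
    charFun (inverseSumLaw n) t = inverseUniformCharFun t ^ n := by
  induction n generalizing t with
  | zero => simp [inverseSumLaw]
  | succ n ih =>
    have hint : Integrable (fun p : ℝ × ℝ => Complex.exp (t * ((p.1 + 1) / p.2 : ℝ) * Complex.I))
        ((inverseSumLaw n).prod (powerLaw n)) := by
      refine (integrable_const (1 : ℝ)).mono (Measurable.aestronglyMeasurable (by fun_prop))
        (Filter.Eventually.of_forall fun p => ?_)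
      rw [← Complex.ofReal_mul, Complex.norm_exp_ofReal_mul_I]; simp
    rw [charFun_apply_real, inverseSumLaw, integral_map (by fun_prop) (by fun_prop),
      integral_prod_symm _ hint]
    have h1 (v : ℝ) : ∫ z, Complex.exp (t * ((z + 1) / v : ℝ) * Complex.I) ∂inverseSumLaw n =
        inverseUniformChar t v * inverseUniformCharFun (t / v) ^ n := by
      rw [← ih, charFun_apply_real, ← integral_const_mul]
      congr 1
      ext z
      rw [inverseUniformChar, ← Complex.exp_add]
      congr 1
      push_cast
      ring
    simp only [h1]
    rw [integral_powerLaw, ← integral_pow_mul_inverseUniformChar,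
      intervalIntegral.integral_of_le zero_le_one, intervalIntegral.integral_of_le zero_le_one]
    refine setIntegral_congr_fun measurableSet_Ioc fun v hv => ?_
    rw [← mul_inverseUniformCharFun_div hv.1]
    ring

/-! ### The Bayes statistic as an inverse uniform variable -/

/-- The standard normal distribution function. -/
def stdNormalCdf (x : ℝ) : ℝ := ∫ u in Iic x, gaussianPDFReal 0 1 u

theorem stdNormalCdf_pos (x : ℝ) : 0 < stdNormalCdf x := by
  rw [stdNormalCdf, setIntegral_pos_iff_support_of_nonneg_ae
    (Filter.Eventually.of_forall fun u => gaussianPDFReal_nonneg 0 1 u)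
    (integrable_gaussianPDFReal 0 1).integrableOn]
  have : Function.support (gaussianPDFReal 0 1) = univ := by
    ext u; simp [(gaussianPDFReal_pos 0 1 u one_ne_zero).ne']
  rw [this]; simp

theorem hasDerivAt_stdNormalCdf (x : ℝ) : HasDerivAt stdNormalCdf (gaussianPDFReal 0 1 x) x := by
  have hint := integrable_gaussianPDFReal 0 1
  have hcont : Continuous (gaussianPDFReal 0 1) := by unfold gaussianPDFReal; fun_prop
  have h : stdNormalCdf = fun y => stdNormalCdf 0 + ∫ u in (0 : ℝ)..y, gaussianPDFReal 0 1 u := by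
    ext y
    rw [← intervalIntegral.integral_Iic_sub_Iic hint.integrableOn hint.integrableOn, stdNormalCdf,
      stdNormalCdf, add_sub_cancel]
  rw [h]
  exact (intervalIntegral.integral_hasDerivAt_right hint.intervalIntegrable
    hcont.stronglyMeasurable.stronglyMeasurableAtFilter hcont.continuousAt).const_add _

theorem strictMono_stdNormalCdf : StrictMono stdNormalCdf :=
  strictMono_of_hasDerivAt_pos hasDerivAt_stdNormalCdf
    fun x => gaussianPDFReal_pos 0 1 x one_ne_zero

theorem stdNormalCdf_eq_cdf : stdNormalCdf = cdf (gaussianReal 0 1) := by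
  ext x
  rw [cdf_eq_real, measureReal_def, gaussianReal_apply_eq_integral 0 one_ne_zero,
    ENNReal.toReal_ofReal (integral_nonneg fun u => gaussianPDFReal_nonneg 0 1 u)]
  rfl

theorem image_stdNormalCdf : stdNormalCdf '' univ = Ioo 0 1 := by
  have hc : Continuous stdNormalCdf :=
    continuous_iff_continuousAt.2 fun x => (hasDerivAt_stdNormalCdf x).continuousAt
  have hbot := tendsto_cdf_atBot (gaussianReal 0 1)
  have htop := tendsto_cdf_atTop (gaussianReal 0 1)
  rw [← stdNormalCdf_eq_cdf] at hbot htop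
  ext u
  constructor
  · rintro ⟨x, -, rfl⟩
    refine ⟨stdNormalCdf_pos x, (strictMono_stdNormalCdf (lt_add_one x)).trans_le ?_⟩
    rw [stdNormalCdf_eq_cdf]
    exact cdf_le_one _ _
  · rintro ⟨h0, h1⟩
    obtain ⟨a, ha⟩ := (hbot.eventually_lt_const h0).exists
    obtain ⟨b, hb⟩ := (htop.eventually_const_lt h1).exists
    obtain ⟨x, hx⟩ := mem_range_of_exists_le_of_exists_ge hc ⟨a, ha.le⟩ ⟨b, hb.le⟩
    exact ⟨x, mem_univ _, hx⟩

/-- Numerator and denominator of `S` add up to `√(2π)`, and the denominator is `√(2π) Φ(x)`. -/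
theorem one_add_bayesS (x : ℝ) : 1 + bayesS x = 1 / stdNormalCdf x := by
  set c : ℝ := Real.sqrt (2 * Real.pi) with hc
  have hc0 : 0 < c := by positivity
  have hq : (fun θ : ℝ => Real.exp (-(x - θ) ^ 2 / 2)) =
      fun θ => c * gaussianPDFReal 0 1 (x - θ) := by
    ext θ
    simp only [gaussianPDFReal, NNReal.coe_one, mul_one, sub_zero]
    rw [← mul_assoc, mul_inv_cancel₀ hc0.ne', one_mul]
  have hint : Integrable fun θ => c * gaussianPDFReal 0 1 (x - θ) :=
    ((integrable_gaussianPDFReal 0 1).comp_sub_left x).const_mul c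
  have hden : ∫ θ in Ici (0 : ℝ), Real.exp (-(x - θ) ^ 2 / 2) = c * stdNormalCdf x := by
    rw [hq, integral_const_mul, stdNormalCdf]
    congr 1
    have := (Measure.measurePreserving_sub_left (volume : Measure ℝ) x).setIntegral_preimage_emb
      (MeasurableEquiv.subLeft x).measurableEmbedding (gaussianPDFReal 0 1) (Iic x)
    rw [← this]
    congr 2
    ext θ; simp
  have hsum : (∫ θ in Iic (0 : ℝ), Real.exp (-(x - θ) ^ 2 / 2)) +
      ∫ θ in Ici (0 : ℝ), Real.exp (-(x - θ) ^ 2 / 2) = c := by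
    rw [hq, integral_Ici_eq_integral_Ioi, intervalIntegral.integral_Iic_add_Ioi hint.integrableOn
      hint.integrableOn, integral_const_mul, integral_sub_left_eq_self (gaussianPDFReal 0 1),
      integral_gaussianPDFReal_eq_one 0 one_ne_zero, mul_one]
  have hpos := stdNormalCdf_pos x
  rw [bayesS, eq_sub_of_add_eq hsum, hden]
  field_simp
  ring

@[fun_prop]
theorem measurable_bayesS : Measurable bayesS := by
  have h : bayesS = fun x => 1 / stdNormalCdf x - 1 := by
    ext x; rw [← one_add_bayesS]; ring
  have hm := strictMono_stdNormalCdf.monotone.measurable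
  rw [h]
  fun_prop

/-- Substitution `u = Φ(x)`, a bijection onto `(0, 1)` with the Gaussian density as Jacobian. -/
theorem charFun_map_one_add_bayesS (t : ℝ) :
    charFun ((gaussianReal 0 1).map fun x => 1 + bayesS x) t = inverseUniformCharFun t := by
  rw [charFun_apply_real, integral_map (by fun_prop)
      (Measurable.aestronglyMeasurable (by fun_prop)),
    integral_gaussianReal_eq_integral_smul one_ne_zero, inverseUniformCharFun,
    intervalIntegral.integral_of_le zero_le_one, integral_Ioc_eq_integral_Ioo, ← image_stdNormalCdf,
    integral_image_eq_integral_abs_deriv_smul MeasurableSet.univ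
      (fun x _ => (hasDerivAt_stdNormalCdf x).hasDerivWithinAt)
      strictMono_stdNormalCdf.injective.injOn, setIntegral_univ]
  refine integral_congr_ae (Filter.Eventually.of_forall fun x => ?_)
  simp only [one_add_bayesS, abs_of_nonneg (gaussianPDFReal_nonneg 0 1 x), inverseUniformChar]
  congr 3
  push_cast
  ring

/-- The sum of `1 + S(ξ_t)` over independent standard normal `ξ_t` is a sum of independent inverses
of uniform variables. -/
theorem hasLaw_sum_one_add_bayesS {ι Ω : Type*} [Fintype ι] [MeasurableSpace Ω] {P : Measure Ω}
    [IsProbabilityMeasure P] {ξ : ι → Ω → ℝ} (hξ : ∀ t, HasLaw (ξ t) (gaussianReal 0 1) P)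
    (hind : iIndepFun ξ P) :
    HasLaw (fun ω => ∑ t, (1 + bayesS (ξ t ω))) (inverseSumLaw (Fintype.card ι)) P := by
  have hm : ∀ t, AEMeasurable (fun ω => 1 + bayesS (ξ t ω)) P := fun t =>
    Measurable.comp_aemeasurable (g := fun x => 1 + bayesS x) (by fun_prop) (hξ t).aemeasurable
  refine ⟨by fun_prop, ?_⟩
  have := Measure.isProbabilityMeasure_map (μ := P) (f := fun ω => ∑ t, (1 + bayesS (ξ t ω)))
    (by fun_prop)
  refine Measure.ext_of_charFun ?_
  have hind' : iIndepFun (fun t ω => 1 + bayesS (ξ t ω)) P :=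
    hind.comp (fun _ x => 1 + bayesS x) fun _ => by fun_prop
  rw [hind'.charFun_map_fun_sum_eq_prod hm]
  ext t
  have h1 (i : ι) : P.map (fun ω => 1 + bayesS (ξ i ω)) =
      (gaussianReal 0 1).map fun x => 1 + bayesS x := by
    rw [← (hξ i).map_eq, AEMeasurable.map_map_of_aemeasurable (by fun_prop) (hξ i).aemeasurable]
    rfl
  simp [h1, charFun_map_one_add_bayesS, charFun_inverseSumLaw]

/-! ### Moments of centered partial sums and of the dominating series -/

theorem mgf_expMeasure_one {Ω : Type*} [MeasurableSpace Ω] {P : Measure Ω} {X : Ω → ℝ}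
    (hX : HasLaw X (expMeasure 1) P) {s : ℝ} (hs : s < 1) : mgf X P s = 1 / (1 - s) := by
  rw [mgf, ← integral_map (f := fun x => Real.exp (s * x)) hX.aemeasurable (by fun_prop),
    hX.map_eq, expMeasure_one_eq_erlang, erlang,
    integral_withDensity_eq_integral_toReal_smul (by fun_prop) (by simp)]
  have h : ∀ x : ℝ, (ENNReal.ofReal (x ^ 0 / Nat.factorial 0 * Real.exp (-x))).toReal •
      Real.exp (s * x) = Real.exp ((s - 1) * x) := by
    intro x
    rw [ENNReal.toReal_ofReal (by positivity), smul_eq_mul]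
    simp only [pow_zero, Nat.factorial_zero, Nat.cast_one, div_one, one_mul, ← Real.exp_add]
    congr 1
    ring
  simp only [h]
  rw [integral_exp_mul_Ioi (by linarith), mul_zero, Real.exp_zero, neg_div, ← div_neg, neg_sub]

/-- Because `(1 - s)(1 + s + 2s²) = 1 + s²(1 - 2s) ≥ 1`. -/
theorem one_div_one_sub_le_exp {s : ℝ} (hs : s ≤ 1 / 2) :
    1 / (1 - s) ≤ Real.exp (s + 2 * s ^ 2) := by
  have h1 := Real.add_one_le_exp (s + 2 * s ^ 2)
  rw [div_le_iff₀ (by linarith)]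
  nlinarith [sq_nonneg s]

/-- The partial sum of order `k`, centered. -/
def centeredSum {Ω : Type*} (κ : ℕ → Ω → ℝ) (k : ℕ) (ω : Ω) : ℝ := partialSum κ k ω - k

/-- A constant in the moment bound for the centered partial sums. -/
def momentConst (q : ℕ) : ℝ := 8 * (2 * q).factorial

theorem momentConst_nonneg (q : ℕ) : 0 ≤ momentConst q := by unfold momentConst; positivity

/-- The summand dominating `zetaTerm`. -/
def tailTerm {Ω : Type*} (κ : ℕ → Ω → ℝ) (k : ℕ) (ω : Ω) : ℝ :=
  |centeredSum κ (k + 1) ω| / (k + 1) ^ 2 + |centeredSum κ (k + 1) ω| ^ 3 / (k + 1) ^ 3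

/-- The tail of the dominating series. -/
def tailSum {Ω : Type*} (κ : ℕ → Ω → ℝ) (n : ℕ) (ω : Ω) : ℝ := ∑' k, tailTerm κ (k + n) ω

/-- A constant in the moment bound for `tailTerm`. -/
def tailConst (q : ℕ) : ℝ := momentConst q + momentConst (3 * q) ^ 3

theorem tailConst_nonneg (q : ℕ) : 0 ≤ tailConst q := by
  have := momentConst_nonneg q
  have := momentConst_nonneg (3 * q)
  unfold tailConst; positivity

theorem tailTerm_nonneg {Ω : Type*} (κ : ℕ → Ω → ℝ) (k : ℕ) (ω : Ω) : 0 ≤ tailTerm κ k ω := by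
  unfold tailTerm; positivity

theorem eLpNorm_pow_abs_le {Ω : Type*} [MeasurableSpace Ω] {P : Measure Ω} {f : Ω → ℝ} {j q : ℕ}
    {c : ℝ} (hc : 0 ≤ c) (hj : 0 < j)
    (h : eLpNorm f (2 * (j * q) : ℕ) P ≤ ENNReal.ofReal c) :
    eLpNorm (fun ω => |f ω| ^ j) (2 * q : ℕ) P ≤ ENNReal.ofReal (c ^ j) := by
  have h1 := eLpNorm_norm_rpow (p := ((2 * q : ℕ) : ℝ≥0∞)) (μ := P) f (q := j) (by positivity)
  simp only [Real.rpow_natCast, ENNReal.rpow_natCast, Real.norm_eq_abs, ENNReal.ofReal_natCast] at h1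
  rw [h1, ENNReal.ofReal_pow hc]
  refine pow_le_pow_left' (le_trans (le_of_eq ?_) h) j
  congr 1
  push_cast
  ring

/-- A telescoping majorant of `(k+1)^{-3/2}`; it yields the rate `n^{-1/2}` for tails. -/
theorem rpow_three_halves_inv_le {k : ℕ} (hk : 1 ≤ k) :
    1 / (((k : ℝ) + 1) * √((k : ℝ) + 1)) ≤ 2 * (1 / √(k : ℝ) - 1 / √((k : ℝ) + 1)) := by
  have hk : (1 : ℝ) ≤ k := by exact_mod_cast hk
  set a := √(k : ℝ) with ha
  set b := √((k : ℝ) + 1) with hb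
  have ha0 : 0 < a := Real.sqrt_pos.2 (by linarith)
  have hab : a ≤ b := Real.sqrt_le_sqrt (by linarith)
  have hb0 : 0 < b := ha0.trans_le hab
  have hb2 : b ^ 2 = k + 1 := Real.sq_sqrt (by linarith)
  have ha2 : a ^ 2 = k := Real.sq_sqrt (by linarith)
  have hd : (b - a) * (b + a) = 1 := by nlinarith
  have e : 1 / a - 1 / b = 1 / (a * b * (b + a)) := by
    field_simp
    linarith
  rw [e, ← hb2, mul_one_div, div_le_div_iff₀ (by positivity) (by positivity)]
  have h1 : a * b * (b + a) ≤ b * b * (b + b) := by gcongr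
  linarith

theorem sum_inv_three_halves_le {n : ℕ} (hn : 1 ≤ n) (N : ℕ) :
    ∑ k ∈ Finset.range N, 1 / (((k + n : ℕ) : ℝ) + 1) / √(((k + n : ℕ) : ℝ) + 1) ≤ 2 / √(n : ℝ) := by
  have h : ∀ N, ∑ k ∈ Finset.range N, 1 / (((k + n : ℕ) : ℝ) + 1) / √(((k + n : ℕ) : ℝ) + 1) ≤
      2 * (1 / √(n : ℝ) - 1 / √((N + n : ℕ) : ℝ)) := by
    intro N
    induction N with
    | zero => simp
    | succ N ih =>
      have := rpow_three_halves_inv_le (k := N + n) (by omega)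
      rw [Finset.sum_range_succ, div_div]
      have e : ((N + 1 + n : ℕ) : ℝ) = ((N + n : ℕ) : ℝ) + 1 := by push_cast; ring
      rw [e]
      linarith
  refine (h N).trans ?_
  have : 0 ≤ 1 / √((N + n : ℕ) : ℝ) := by positivity
  rw [mul_sub, mul_one_div]
  linarith

section Moments

variable {Ω : Type*} [MeasurableSpace Ω] {P : Measure Ω} {κ : ℕ → Ω → ℝ}

theorem aemeasurable_centeredSum (hκ : ∀ l, AEMeasurable (κ l) P) (k : ℕ) :
    AEMeasurable (centeredSum κ k) P := by
  have := aemeasurable_partialSum hκ k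
  unfold centeredSum; fun_prop

theorem aemeasurable_tailTerm (hκ : ∀ l, AEMeasurable (κ l) P) (k : ℕ) :
    AEMeasurable (tailTerm κ k) P := by
  have := aemeasurable_centeredSum hκ (k + 1)
  unfold tailTerm; fun_prop

theorem lintegral_exp_centeredSum_le (hκ : ∀ l, HasLaw (κ l) (expMeasure 1) P)
    (hind : iIndepFun κ P) {s : ℝ} (hs : s ≤ 1 / 2) (k : ℕ) :
    ∫⁻ ω, ENNReal.ofReal (Real.exp (s * centeredSum κ k ω)) ∂P ≤
      ENNReal.ofReal (Real.exp (2 * k * s ^ 2)) := by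
  have hs1 : 0 < 1 - s := by linarith
  have hm : mgf (partialSum κ k) P s = (1 / (1 - s)) ^ k := by
    have h : partialSum κ k = ∑ l ∈ Finset.range k, κ l := by ext ω; simp [partialSum]
    rw [h, hind.mgf_sum₀ (fun l => (hκ l).aemeasurable),
      Finset.prod_congr rfl fun l _ => mgf_expMeasure_one (hκ l) (by linarith)]
    simp
  have hint : Integrable (fun ω => Real.exp (s * partialSum κ k ω)) P :=
    -- A non-integrable function has Bochner integral `0`, so a nonzero value proves integrability.
    Integrable.of_integral_ne_zero (by
      change mgf (partialSum κ k) P s ≠ 0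
      rw [hm]; positivity)
  have e : ∀ ω, Real.exp (s * centeredSum κ k ω) =
      Real.exp (-(s * k)) * Real.exp (s * partialSum κ k ω) := by
    intro ω
    rw [← Real.exp_add, centeredSum]
    congr 1
    ring
  simp only [e]
  rw [← ofReal_integral_eq_lintegral_ofReal (hint.const_mul _)
    (Filter.Eventually.of_forall fun ω => by positivity), integral_const_mul]
  refine ENNReal.ofReal_le_ofReal ?_
  change Real.exp (-(s * k)) * mgf (partialSum κ k) P s ≤ _
  rw [hm]
  calc Real.exp (-(s * k)) * (1 / (1 - s)) ^ k
      ≤ Real.exp (-(s * k)) * Real.exp (s + 2 * s ^ 2) ^ k := by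
        gcongr; exact one_div_one_sub_le_exp hs
    _ = Real.exp (2 * k * s ^ 2) := by
        rw [← Real.exp_nat_mul, ← Real.exp_add]; congr 1; ring

theorem eLpNorm_centeredSum_le (hκ : ∀ l, HasLaw (κ l) (expMeasure 1) P)
    (hind : iIndepFun κ P) {q : ℕ} (hq : 1 ≤ q) {k : ℕ} (hk : 1 ≤ k) :
    eLpNorm (centeredSum κ k) (2 * q : ℕ) P ≤ ENNReal.ofReal (momentConst q * √(k : ℝ)) := by
  have hk1 : (1 : ℝ) ≤ k := by exact_mod_cast hk
  have hr1 : 1 ≤ √(k : ℝ) := Real.one_le_sqrt.2 hk1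
  have hr2 : √(k : ℝ) ^ 2 = k := Real.sq_sqrt (by linarith)
  set r := √(k : ℝ) with hr
  -- At the scale `s = 1/(2√k)` both exponential moments are at most `e^{1/2} ≤ 2`, and `s ≤ 1/2`
  -- since `k ≥ 1`.
  set s : ℝ := 1 / (2 * r) with hs
  have hs0 : 0 < s := by positivity
  have hs2 : s ≤ 1 / 2 := by
    rw [hs]; apply one_div_le_one_div_of_le <;> linarith
  have hexp : Real.exp (2 * k * s ^ 2) ≤ 2 := by
    have : 2 * (k : ℝ) * s ^ 2 = 1 / 2 := by
      rw [hs, ← hr2]; field_simp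
    rw [this]
    have h1 := Real.exp_one_lt_three
    have h2 : Real.exp (1 / 2) ^ 2 = Real.exp 1 := by rw [← Real.exp_nat_mul]; norm_num
    nlinarith [Real.exp_pos (1 / 2)]
  set A : ℝ := ((2 * q).factorial : ℝ) with hA
  have hA1 : 1 ≤ A := by
    rw [hA]; exact Nat.one_le_cast.2 (Nat.one_le_iff_ne_zero.2 (Nat.factorial_ne_zero _))
  have hpt : ∀ y : ℝ, |y| ^ (2 * q) ≤
      A * (2 * r) ^ (2 * q) * (Real.exp (s * y) + Real.exp (-s * y)) := by
    intro y
    have h1 := Real.pow_div_factorial_le_exp (s * |y|) (by positivity) (2 * q)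
    have h2 : Real.exp (s * |y|) ≤ Real.exp (s * y) + Real.exp (-s * y) := by
      rcases abs_cases y with ⟨h, -⟩ | ⟨h, -⟩ <;> rw [h]
      · linarith [Real.exp_pos (-s * y)]
      · rw [mul_neg, ← neg_mul]; linarith [Real.exp_pos (s * y)]
    have h3 : |y| ^ (2 * q) = A * (2 * r) ^ (2 * q) * ((s * |y|) ^ (2 * q) / A) := by
      rw [mul_pow s, hs, div_pow, one_pow]
      field_simp
    rw [h3]
    gcongr
    exact h1.trans h2
  have hlint : ∫⁻ ω, ‖centeredSum κ k ω‖ₑ ^ (2 * q) ∂P ≤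
      ENNReal.ofReal (4 * A * (2 * r) ^ (2 * q)) := by
    calc ∫⁻ ω, ‖centeredSum κ k ω‖ₑ ^ (2 * q) ∂P
        ≤ ∫⁻ ω, ENNReal.ofReal (A * (2 * r) ^ (2 * q)) *
            (ENNReal.ofReal (Real.exp (s * centeredSum κ k ω)) +
              ENNReal.ofReal (Real.exp (-s * centeredSum κ k ω))) ∂P := by
          refine lintegral_mono fun ω => ?_
          rw [← ENNReal.ofReal_add (by positivity) (by positivity),
            ← ENNReal.ofReal_mul (by positivity), Real.enorm_eq_ofReal_abs,
            ← ENNReal.ofReal_pow (abs_nonneg _)]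
          exact ENNReal.ofReal_le_ofReal (hpt _)
      _ = ENNReal.ofReal (A * (2 * r) ^ (2 * q)) *
            (∫⁻ ω, ENNReal.ofReal (Real.exp (s * centeredSum κ k ω)) ∂P +
              ∫⁻ ω, ENNReal.ofReal (Real.exp (-s * centeredSum κ k ω)) ∂P) := by
          have := aemeasurable_centeredSum (fun l => (hκ l).aemeasurable) k
          rw [lintegral_const_mul' _ _ ENNReal.ofReal_ne_top, lintegral_add_left' (by fun_prop)]
      _ ≤ ENNReal.ofReal (A * (2 * r) ^ (2 * q)) * (ENNReal.ofReal 2 + ENNReal.ofReal 2) := by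
          gcongr
          · exact (lintegral_exp_centeredSum_le hκ hind hs2 k).trans
              (ENNReal.ofReal_le_ofReal hexp)
          · refine (lintegral_exp_centeredSum_le hκ hind (by linarith) k).trans
              (ENNReal.ofReal_le_ofReal ?_)
            rwa [neg_sq]
      _ = ENNReal.ofReal (4 * A * (2 * r) ^ (2 * q)) := by
          rw [← ENNReal.ofReal_add (by norm_num) (by norm_num),
            ← ENNReal.ofReal_mul (by positivity)]
          congr 1; ring
  rw [eLpNorm_eq_lintegral_rpow_enorm_toReal (by simp; omega) (ENNReal.natCast_ne_top _),
    ENNReal.toReal_natCast]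
  simp only [ENNReal.rpow_natCast]
  rw [one_div, ENNReal.rpow_inv_le_iff (by positivity), ENNReal.rpow_natCast,
    ← ENNReal.ofReal_pow (by have := momentConst_nonneg q; positivity)]
  refine hlint.trans (ENNReal.ofReal_le_ofReal ?_)
  -- The factor `4A ≥ 1` is replaced by its `2q`-th power, which avoids a root and explains the `8 =
  -- 4 · 2` in `momentConst`.
  have e : (momentConst q * r) ^ (2 * q) = (4 * A) ^ (2 * q) * (2 * r) ^ (2 * q) := by
    rw [← mul_pow, momentConst]; congr 1; ring
  rw [e]
  gcongr
  exact le_self_pow₀ (by linarith) (by omega)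

/-- As `E_k - k` is of order `√k`, both summands are of order `k^{-3/2}`. The cube is the least
integer power of `|E_k - k|/k` whose norms are summable in this way. -/
theorem eLpNorm_tailTerm_le (hκ : ∀ l, HasLaw (κ l) (expMeasure 1) P)
    (hind : iIndepFun κ P) {q : ℕ} (hq : 1 ≤ q) (k : ℕ) :
    eLpNorm (tailTerm κ k) (2 * q : ℕ) P ≤
      ENNReal.ofReal (tailConst q * (1 / ((k : ℝ) + 1) / √((k : ℝ) + 1))) := by
  have hm := aemeasurable_centeredSum (fun l => (hκ l).aemeasurable) (k + 1)
  have hY1 := eLpNorm_centeredSum_le hκ hind hq (Nat.le_add_left 1 k)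
  have hY3 := eLpNorm_centeredSum_le hκ hind (q := 3 * q) (by omega) (Nat.le_add_left 1 k)
  have hc1 := momentConst_nonneg q
  have hc3 := momentConst_nonneg (3 * q)
  have hk0 : (0 : ℝ) ≤ (k : ℝ) + 1 := by positivity
  push_cast at hY1 hY3
  set r := √((k : ℝ) + 1) with hr
  have hr0 : 0 < r := Real.sqrt_pos.2 (by positivity)
  have hr2 : r ^ 2 = (k : ℝ) + 1 := Real.sq_sqrt (by positivity)
  have h1 := eLpNorm_pow_abs_le (f := centeredSum κ (k + 1)) (j := 1) (q := q) (c := momentConst q * r)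
    (by positivity) one_pos (by push_cast; rw [one_mul]; exact hY1)
  have h3 := eLpNorm_pow_abs_le (f := centeredSum κ (k + 1)) (j := 3) (q := q)
    (c := momentConst (3 * q) * r) (by positivity) (by norm_num) (by push_cast; exact hY3)
  have e : tailTerm κ k = (((k : ℝ) + 1) ^ 2)⁻¹ • (fun ω => |centeredSum κ (k + 1) ω| ^ 1) +
      (((k : ℝ) + 1) ^ 3)⁻¹ • (fun ω => |centeredSum κ (k + 1) ω| ^ 3) := by
    ext ω
    simp only [tailTerm, Pi.add_apply, Pi.smul_apply, smul_eq_mul, pow_one]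
    ring
  rw [e]
  refine (eLpNorm_add_le (AEMeasurable.aestronglyMeasurable (by fun_prop))
    (AEMeasurable.aestronglyMeasurable (by fun_prop)) (by exact_mod_cast (by omega : 1 ≤ 2 * q))).trans ?_
  rw [eLpNorm_const_smul, eLpNorm_const_smul, Real.enorm_eq_ofReal (by positivity),
    Real.enorm_eq_ofReal (by positivity)]
  refine (add_le_add (mul_le_mul_right h1 _) (mul_le_mul_right h3 _)).trans (le_of_eq ?_)
  rw [← ENNReal.ofReal_mul (by positivity), ← ENNReal.ofReal_mul (by positivity),
    ← ENNReal.ofReal_add (by positivity) (by positivity)]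
  congr 1
  rw [tailConst, ← hr2]
  field_simp

variable [IsProbabilityMeasure P]

theorem ae_summable_tailTerm (hκ : ∀ l, HasLaw (κ l) (expMeasure 1) P) (hind : iIndepFun κ P) :
    ∀ᵐ ω ∂P, Summable fun k => tailTerm κ k ω := by
  have hm := aemeasurable_tailTerm (fun l => (hκ l).aemeasurable)
  have hlint : ∀ k, ∫⁻ ω, ENNReal.ofReal (tailTerm κ k ω) ∂P ≤
      ENNReal.ofReal (tailConst 1 * (1 / ((k : ℝ) + 1) / √((k : ℝ) + 1))) := by
    intro k
    refine le_trans (le_of_eq ?_) ((eLpNorm_le_eLpNorm_of_exponent_le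
      (p := 1) (by norm_num) (hm k).aestronglyMeasurable).trans
      (eLpNorm_tailTerm_le hκ hind le_rfl k))
    rw [eLpNorm_one_eq_lintegral_enorm]
    refine lintegral_congr fun ω => ?_
    rw [Real.enorm_eq_ofReal (tailTerm_nonneg κ k ω)]
  have hsum : Summable fun k : ℕ => tailConst 1 * (1 / ((k : ℝ) + 1) / √((k : ℝ) + 1)) := by
    refine Summable.mul_left _ ((summable_nat_add_iff 1).1 ?_)
    refine summable_of_sum_range_le (c := 2) (fun k => by positivity) fun N => ?_
    simpa using sum_inv_three_halves_le le_rfl N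
  have hfin : ∫⁻ ω, ∑' k, ENNReal.ofReal (tailTerm κ k ω) ∂P ≠ ∞ := by
    rw [lintegral_tsum (fun k => (hm k).ennreal_ofReal)]
    exact ne_top_of_le_ne_top hsum.tsum_ofReal_ne_top (ENNReal.tsum_le_tsum hlint)
  filter_upwards [ae_lt_top' (AEMeasurable.tsum fun k => (hm k).ennreal_ofReal) hfin]
    with ω hω
  have := ENNReal.summable_toReal hω.ne
  simpa [ENNReal.toReal_ofReal (tailTerm_nonneg κ _ ω)] using this

/-- Minkowski's inequality for finite sums, then Fatou's lemma. -/
theorem eLpNorm_tailSum_le (hκ : ∀ l, HasLaw (κ l) (expMeasure 1) P) (hind : iIndepFun κ P)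
    {q n : ℕ} (hq : 1 ≤ q) (hn : 1 ≤ n) :
    eLpNorm (tailSum κ n) (2 * q : ℕ) P ≤ ENNReal.ofReal (2 * tailConst q / √(n : ℝ)) := by
  have hm := aemeasurable_tailTerm (fun l => (hκ l).aemeasurable)
  have hc := tailConst_nonneg q
  have hb : ∀ N : ℕ, eLpNorm (∑ k ∈ Finset.range N, tailTerm κ (k + n)) (2 * q : ℕ) P ≤
      ENNReal.ofReal (2 * tailConst q / √(n : ℝ)) := by
    intro N
    refine (eLpNorm_sum_le (fun k _ => (hm _).aestronglyMeasurable)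
      (by exact_mod_cast (by omega : 1 ≤ 2 * q))).trans ?_
    refine (Finset.sum_le_sum fun k _ => eLpNorm_tailTerm_le hκ hind hq (k + n)).trans ?_
    rw [← ENNReal.ofReal_sum_of_nonneg (fun k _ => by positivity), ← Finset.mul_sum]
    refine ENNReal.ofReal_le_ofReal ?_
    have := mul_le_mul_of_nonneg_left (sum_inv_three_halves_le hn N) hc
    exact this.trans (le_of_eq (by ring))
  refine (Lp.eLpNorm_lim_le_liminf_eLpNorm
    (f := fun N => ∑ k ∈ Finset.range N, tailTerm κ (k + n))
    (fun N => Finset.aestronglyMeasurable_sum _ fun k _ => (hm _).aestronglyMeasurable) _ ?_).trans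
    (Filter.liminf_le_of_le (by isBoundedDefault) fun b hb' => ?_)
  · filter_upwards [ae_summable_tailTerm hκ hind] with ω hω
    have := ((summable_nat_add_iff n).2 hω).hasSum.tendsto_sum_nat
    simpa [tailSum] using this
  · obtain ⟨N, hN⟩ := hb'.exists
    exact hN.trans (hb N)

theorem aemeasurable_tailSum (hκ : ∀ l, HasLaw (κ l) (expMeasure 1) P) (hind : iIndepFun κ P)
    (n : ℕ) : AEMeasurable (tailSum κ n) P := by
  have hm := aemeasurable_tailTerm (fun l => (hκ l).aemeasurable)
  refine aemeasurable_of_tendsto_metrizable_ae Filter.atTop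
    (f := fun N ω => ∑ k ∈ Finset.range N, tailTerm κ (k + n) ω) (fun N => by fun_prop) ?_
  filter_upwards [ae_summable_tailTerm hκ hind] with ω hω
  exact ((summable_nat_add_iff n).2 hω).hasSum.tendsto_sum_nat

end Moments

/-! ### Pointwise control of the tail and of the relative error -/

section Pointwise

variable {Ω : Type*} {κ : ℕ → Ω → ℝ} {ω : Ω}

theorem abs_zetaTerm_le {k : ℕ} (h : ((k : ℝ) + 1) / 2 ≤ partialSum κ (k + 1) ω) :
    |zetaTerm κ k ω| ≤ 2 * tailTerm κ k ω := by
  have hk : (0 : ℝ) < (k : ℝ) + 1 := by positivity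
  have hE : 0 < partialSum κ (k + 1) ω := by linarith
  have hY : centeredSum κ (k + 1) ω = partialSum κ (k + 1) ω - (k + 1) := by
    simp [centeredSum]
  have e : zetaTerm κ k ω =
      -(centeredSum κ (k + 1) ω / ((k + 1) * partialSum κ (k + 1) ω)) := by
    rw [zetaTerm, hY]; field_simp; ring
  have h1 : |zetaTerm κ k ω| ≤ |centeredSum κ (k + 1) ω| / ((k + 1) * ((k + 1) / 2)) := by
    rw [e, abs_neg, abs_div, abs_of_pos (mul_pos hk hE)]
    gcongr
  have h2 : |centeredSum κ (k + 1) ω| / (((k : ℝ) + 1) * ((k + 1) / 2)) =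
      2 * (|centeredSum κ (k + 1) ω| / (k + 1) ^ 2) := by field_simp
  have h3 : 0 ≤ |centeredSum κ (k + 1) ω| ^ 3 / ((k : ℝ) + 1) ^ 3 := by positivity
  rw [tailTerm]
  linarith

/-- On the bad event the deviation is at least `(k+1)/2`, so the cubic summand alone reaches `1/8`.
-/
theorem le_tailTerm {k : ℕ} (h : partialSum κ (k + 1) ω ≤ ((k : ℝ) + 1) / 2) :
    1 / 8 ≤ tailTerm κ k ω := by
  have hk : (0 : ℝ) < (k : ℝ) + 1 := by positivity
  have hY : ((k : ℝ) + 1) / 2 ≤ |centeredSum κ (k + 1) ω| := by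
    rw [centeredSum]
    push_cast
    rw [abs_sub_comm]
    exact le_trans (by linarith) (le_abs_self _)
  have h1 : 1 / 8 = (((k : ℝ) + 1) / 2) ^ 3 / (k + 1) ^ 3 := by field_simp; norm_num
  have h2 : (((k : ℝ) + 1) / 2) ^ 3 / (k + 1) ^ 3 ≤
      |centeredSum κ (k + 1) ω| ^ 3 / (k + 1) ^ 3 := by gcongr
  have h3 : 0 ≤ |centeredSum κ (k + 1) ω| / ((k : ℝ) + 1) ^ 2 := by positivity
  rw [tailTerm]
  linarith

/-- Needs no lower bound such as `E_k ≥ k/2`: only small `E_k` are dangerous, and they make the term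
positive. -/
theorem neg_zetaTerm_le {k : ℕ} (h : 0 < partialSum κ (k + 1) ω) :
    -zetaTerm κ k ω ≤ tailTerm κ k ω := by
  have hk : (0 : ℝ) < (k : ℝ) + 1 := by positivity
  rcases le_total ((k : ℝ) + 1) (partialSum κ (k + 1) ω) with hE | hE
  · have hY : |centeredSum κ (k + 1) ω| = partialSum κ (k + 1) ω - (k + 1) := by
      rw [centeredSum, abs_of_nonneg] <;> push_cast <;> linarith
    have e : -zetaTerm κ k ω =
        |centeredSum κ (k + 1) ω| / ((k + 1) * partialSum κ (k + 1) ω) := by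
      rw [zetaTerm, hY]; field_simp; ring
    have h1 : |centeredSum κ (k + 1) ω| / ((k + 1) * partialSum κ (k + 1) ω) ≤
        |centeredSum κ (k + 1) ω| / ((k : ℝ) + 1) ^ 2 := by
      rw [sq]; gcongr
    have h3 : 0 ≤ |centeredSum κ (k + 1) ω| ^ 3 / ((k : ℝ) + 1) ^ 3 := by positivity
    rw [e, tailTerm]
    linarith
  · have : 1 / ((k : ℝ) + 1) ≤ 1 / partialSum κ (k + 1) ω := one_div_le_one_div_of_le h hE
    have := tailTerm_nonneg κ k ω
    rw [zetaTerm]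
    linarith

theorem summable_zetaTerm (hs : Summable fun k => tailTerm κ k ω) :
    Summable fun k => zetaTerm κ k ω := by
  have h := hs.tendsto_atTop_zero.eventually_lt_const (by norm_num : (0 : ℝ) < 1 / 8)
  refine Summable.of_norm_bounded_eventually_nat (hs.mul_left 2) ?_
  filter_upwards [h] with k hk
  refine abs_zetaTerm_le (le_of_lt ?_)
  by_contra! hE
  exact absurd (le_tailTerm hE) (not_le.2 hk)

theorem tailSum_nonneg (κ : ℕ → Ω → ℝ) (n : ℕ) (ω : Ω) : 0 ≤ tailSum κ n ω :=
  tsum_nonneg fun k => tailTerm_nonneg κ (k + n) ω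

theorem sum_zetaTerm (n : ℕ) : ∑ k ∈ Finset.range n, zetaTerm κ k ω =
    inversePartialSum κ n ω - (harmonic n : ℝ) := by
  rw [inversePartialSum, harmonic]
  push_cast
  rw [← Finset.sum_sub_distrib]
  exact Finset.sum_congr rfl fun k _ => by simp [zetaTerm]

theorem harmonic_sub_log_bounds {n : ℕ} (hn : 1 ≤ n) :
    0 ≤ (harmonic n : ℝ) - Real.log n - Real.eulerMascheroniConstant ∧
      (harmonic n : ℝ) - Real.log n - Real.eulerMascheroniConstant ≤ 1 / n := by
  have h1 := Real.eulerMascheroniConstant_lt_eulerMascheroniSeq' n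
  have h2 := Real.eulerMascheroniSeq_lt_eulerMascheroniConstant n
  have hn0 : (0 : ℝ) < n := by exact_mod_cast hn
  rw [Real.eulerMascheroniSeq', if_neg (by omega)] at h1
  rw [Real.eulerMascheroniSeq] at h2
  have h3 : Real.log (n + 1) - Real.log n ≤ 1 / n := by
    rw [← Real.log_div (by positivity) hn0.ne']
    refine (Real.log_le_sub_one_of_pos (by positivity)).trans (le_of_eq ?_)
    field_simp
    ring
  constructor <;> linarith

/-- Keeps `|ζ°| + log n` away from zero; this is where `n ≥ 2` matters. -/
theorem half_le_log {n : ℕ} (hn : 2 ≤ n) : 1 / 2 ≤ Real.log n := by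
  have h2 : (2 : ℝ) ≤ n := by exact_mod_cast hn
  have := Real.log_le_log two_pos h2
  linarith [Real.log_two_gt_d9]

/-- The tail of the series defining `ζ°`, relative to `|ζ°| + log n`. -/
theorem abs_zetaCirc_sub_sum_le (hpos : ∀ n, 0 < partialSum κ (n + 1) ω)
    (hs : Summable fun k => tailTerm κ k ω) {n : ℕ} (hn : 2 ≤ n) :
    |zetaCirc κ ω - ∑ k ∈ Finset.range n, zetaTerm κ k ω| ≤
      24 * tailSum κ n ω * (|zetaCirc κ ω| + Real.log n) := by
  have hz := summable_zetaTerm hs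
  have hL := half_le_log hn
  have hT := tailSum_nonneg κ n ω
  have hsT : Summable fun k => tailTerm κ (k + n) ω := (summable_nat_add_iff n).2 hs
  have hzT : Summable fun k => zetaTerm κ (k + n) ω := (summable_nat_add_iff n).2 hz
  have hR : zetaCirc κ ω - ∑ k ∈ Finset.range n, zetaTerm κ k ω = ∑' k, zetaTerm κ (k + n) ω := by
    rw [zetaCirc, ← hz.sum_add_tsum_nat_add n]; ring
  have hz0 := abs_nonneg (zetaCirc κ ω)
  by_cases hgood : ∀ k, (((k + n : ℕ) : ℝ) + 1) / 2 ≤ partialSum κ (k + n + 1) ω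
  · have h1 : |∑' k, zetaTerm κ (k + n) ω| ≤ 2 * tailSum κ n ω := by
      rw [tailSum, ← tsum_mul_left]
      exact tsum_of_norm_bounded (f := fun k => zetaTerm κ (k + n) ω) (hsT.mul_left 2).hasSum
        fun k => abs_zetaTerm_le (hgood k)
    rw [hR]
    nlinarith
  -- Bad event: the tail is at most `ζ° + H_n ≤ 3(|ζ°| + log n)` because the removed inverses are
  -- positive, and `3 = 24/8` is absorbed by `tailSum ≥ 1/8`.
  · push Not at hgood
    obtain ⟨k, hk⟩ := hgood
    have hT8 : 1 / 8 ≤ tailSum κ n ω := (le_tailTerm hk.le).trans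
      (hsT.le_tsum k fun j _ => tailTerm_nonneg κ (j + n) ω)
    have hlow : -(zetaCirc κ ω - ∑ k ∈ Finset.range n, zetaTerm κ k ω) ≤ tailSum κ n ω := by
      rw [hR, ← tsum_neg]
      exact hzT.neg.tsum_le_tsum (fun k => neg_zetaTerm_le (hpos _)) hsT
    have hup : zetaCirc κ ω - ∑ k ∈ Finset.range n, zetaTerm κ k ω ≤
        3 * (|zetaCirc κ ω| + Real.log n) := by
      have h0 : 0 ≤ inversePartialSum κ n ω :=
        Finset.sum_nonneg fun k _ => (one_div_pos.2 (hpos k)).le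
      have hH : (harmonic n : ℝ) ≤ 1 + Real.log n := harmonic_le_one_add_log n
      rw [sum_zetaTerm]
      linarith [le_abs_self (zetaCirc κ ω)]
    rw [abs_le]
    constructor <;> nlinarith

/-- The deviation of the normalized sum from `ζ° + log n + γ`, relative to `|ζ°| + log n`. -/
def relativeError (κ : ℕ → Ω → ℝ) (n : ℕ) (ω : Ω) : ℝ :=
  (partialSum κ (n + 1) ω * inversePartialSum κ n ω / n - Real.log n -
    Real.eulerMascheroniConstant - zetaCirc κ ω) / (|zetaCirc κ ω| + Real.log n)

/-- The random variable dominating `relativeError`. -/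
def errorBound (κ : ℕ → Ω → ℝ) (n : ℕ) (ω : Ω) : ℝ :=
  (n : ℝ)⁻¹ * |centeredSum κ (n + 1) ω| + 2 * (n : ℝ)⁻¹ ^ 2 * |centeredSum κ (n + 1) ω| ^ 2 +
    5 * (n : ℝ)⁻¹ + tailSum κ n ω + |tailSum κ n ω| ^ 2

theorem abs_relativeError_le (hpos : ∀ n, 0 < partialSum κ (n + 1) ω)
    (hs : Summable fun k => tailTerm κ k ω) {n : ℕ} (hn : 2 ≤ n) :
    |relativeError κ n ω| ≤ 24 * errorBound κ n ω := by
  have hL := half_le_log hn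
  have hn2 : (2 : ℝ) ≤ n := by exact_mod_cast hn
  have hR := abs_zetaCirc_sub_sum_le hpos hs hn
  obtain ⟨hr0, hr1⟩ := harmonic_sub_log_bounds (n := n) (by omega)
  have hT := tailSum_nonneg κ n ω
  have hg0 : 0 ≤ Real.eulerMascheroniConstant := by
    linarith [Real.one_half_lt_eulerMascheroniConstant]
  have hg1 : Real.eulerMascheroniConstant ≤ 1 := by
    linarith [Real.eulerMascheroniConstant_lt_two_thirds]
  set z := zetaCirc κ ω
  set T := tailSum κ n ω with hTdef
  set L := Real.log n
  set g := Real.eulerMascheroniConstant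
  set Y := centeredSum κ (n + 1) ω with hY
  set D := |z| + L with hD
  have hz0 : 0 ≤ |z| := abs_nonneg z
  have hD2 : 1 / 2 ≤ D := by linarith
  set i : ℝ := (n : ℝ)⁻¹ with hi
  have hi0 : 0 < i := by positivity
  have hi1 : i ≤ 1 := inv_le_one_of_one_le₀ (by linarith)
  set r := (harmonic n : ℝ) - L - g with hr
  set R := z - ∑ k ∈ Finset.range n, zetaTerm κ k ω with hRdef
  set η := (Y + 1) * i with hη
  have hE : partialSum κ (n + 1) ω / n = 1 + η := by
    rw [hη, hY, centeredSum, hi]; push_cast; field_simp; ring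
  have hW : inversePartialSum κ n ω = L + g + r + z - R := by
    rw [hRdef, sum_zetaTerm, hr]; ring
  -- Here `η` is the relative error of `E_{n+1}` against `n`, `r` the harmonic error, and `R` the
  -- tail of the series.
  have hΔ : partialSum κ (n + 1) ω * inversePartialSum κ n ω / n - L - g - z =
      η * (z + L + g) + (1 + η) * (r - R) := by
    rw [mul_div_right_comm, hE, hW]; ring
  have hX : |r - R| ≤ D * (24 * (i + T)) := by
    have h1 : |r - R| ≤ |r| + |R| := abs_sub _ _
    rw [abs_of_nonneg hr0] at h1
    rw [one_div] at hr1
    nlinarith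
  have hA : |z + L + g| ≤ 3 * D := by
    rw [abs_le]
    constructor <;> linarith [neg_abs_le z, le_abs_self z]
  have hb : |partialSum κ (n + 1) ω * inversePartialSum κ n ω / n - L - g - z| ≤
      D * (24 * (|η| + (1 + |η|) * (i + T))) := by
    rw [hΔ]
    calc |η * (z + L + g) + (1 + η) * (r - R)|
        ≤ |η| * |z + L + g| + |1 + η| * |r - R| := by
          rw [← abs_mul, ← abs_mul]; exact abs_add_le _ _
      _ ≤ |η| * (3 * D) + (1 + |η|) * (D * (24 * (i + T))) := by
          have : |1 + η| ≤ 1 + |η| := (abs_add_le _ _).trans (by rw [abs_one])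
          gcongr
      _ ≤ _ := by
          have : 0 ≤ |η| * D := by positivity
          nlinarith
  have hη1 : |η| ≤ i * |Y| + i := by
    rw [hη, abs_mul, abs_of_pos hi0]
    have : |Y + 1| ≤ |Y| + 1 := (abs_add_le _ _).trans (by rw [abs_one])
    nlinarith
  have hη2 : |η| ^ 2 ≤ 2 * i ^ 2 * |Y| ^ 2 + 2 * i := by
    have h0 := abs_nonneg η
    have h1 : |η| ^ 2 ≤ (i * |Y| + i) ^ 2 := by gcongr
    nlinarith [sq_nonneg (i * |Y| - i)]
  have hfin : |η| + (1 + |η|) * (i + T) ≤ errorBound κ n ω := by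
    rw [errorBound, ← hTdef, abs_of_nonneg hT, ← hY, ← hi]
    -- The product is split into squares, so that the moments of each factor suffice; this is the
    -- origin of the quadratic terms in `errorBound`.
    have h1 : |η| * (i + T) ≤ |η| ^ 2 / 2 + (i + T) ^ 2 / 2 := by
      linarith [two_mul_le_add_sq |η| (i + T)]
    have h2 : (i + T) ^ 2 ≤ 2 * i + 2 * T ^ 2 := by
      have : i ^ 2 ≤ i := pow_le_of_le_one hi0.le hi1 two_ne_zero
      linarith [add_sq_le (a := i) (b := T)]
    have h3 : 0 ≤ i ^ 2 * |Y| ^ 2 := by positivity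
    linarith
  rw [relativeError, abs_div, abs_of_pos (by linarith : 0 < D), div_le_iff₀ (by linarith)]
  refine hb.trans ?_
  rw [mul_comm D]
  gcongr

end Pointwise

/-! ### Moment bounds for the relative error -/

theorem eLpNorm_add_le_ofReal {Ω : Type*} [MeasurableSpace Ω] {P : Measure Ω} {f g : Ω → ℝ}
    {p : ℝ≥0∞} {a b : ℝ} (hp : 1 ≤ p) (hf : AEMeasurable f P) (hg : AEMeasurable g P) (ha : 0 ≤ a)
    (hb : 0 ≤ b) (hfa : eLpNorm f p P ≤ ENNReal.ofReal a) (hgb : eLpNorm g p P ≤ ENNReal.ofReal b) :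
    eLpNorm (fun ω => f ω + g ω) p P ≤ ENNReal.ofReal (a + b) := by
  rw [ENNReal.ofReal_add ha hb]
  exact (eLpNorm_add_le hf.aestronglyMeasurable hg.aestronglyMeasurable hp).trans
    (add_le_add hfa hgb)

theorem eLpNorm_const_mul_le_ofReal {Ω : Type*} [MeasurableSpace Ω] {P : Measure Ω} {f : Ω → ℝ}
    {p : ℝ≥0∞} {a c : ℝ} (hc : 0 ≤ c) (hfa : eLpNorm f p P ≤ ENNReal.ofReal a) :
    eLpNorm (fun ω => c * f ω) p P ≤ ENNReal.ofReal (c * a) := by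
  have := eLpNorm_const_smul c f p P
  rw [Real.enorm_eq_ofReal hc] at this
  rw [ENNReal.ofReal_mul hc]
  exact this.le.trans (mul_le_mul_right hfa _)

/-- The constant in the moment bound for `relativeError`. -/
def errorConst (m : ℕ) : ℝ :=
  24 * (2 * momentConst m + 4 * momentConst (2 * m) ^ 2 + 5 + 2 * tailConst m +
    4 * tailConst (2 * m) ^ 2)

theorem errorConst_nonneg (m : ℕ) : 0 ≤ errorConst m := by
  have := momentConst_nonneg m
  have := tailConst_nonneg m
  unfold errorConst; positivity

theorem sum_moment_bounds_le {n m : ℕ} (hn : 2 ≤ n) (hc1 : 0 ≤ momentConst m)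
    (hd1 : 0 ≤ tailConst m) :
    (n : ℝ)⁻¹ * (momentConst m * √((n + 1 : ℕ) : ℝ)) +
      2 * (n : ℝ)⁻¹ ^ 2 * (momentConst (2 * m) * √((n + 1 : ℕ) : ℝ)) ^ 2 + 5 * (n : ℝ)⁻¹ +
      2 * tailConst m / √(n : ℝ) + (2 * tailConst (2 * m) / √(n : ℝ)) ^ 2 ≤
    errorConst m / 24 / √(n : ℝ) := by
  have hn2 : (2 : ℝ) ≤ n := by exact_mod_cast hn
  set r := √(n : ℝ) with hr
  have hr2 : r ^ 2 = n := Real.sq_sqrt (by linarith)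
  have hr1 : 1 ≤ r := Real.one_le_sqrt.2 (by linarith)
  have hr0 : 0 < r := by linarith
  have hs2 : √((n + 1 : ℕ) : ℝ) ^ 2 = r ^ 2 + 1 := by
    rw [Real.sq_sqrt (by positivity), hr2]; push_cast; ring
  have hs : √((n + 1 : ℕ) : ℝ) ≤ 2 * r := by
    rw [Real.sqrt_le_left (by positivity)]; push_cast; rw [← hr2]; nlinarith
  have hinv : r⁻¹ ^ 2 ≤ r⁻¹ := by
    rw [sq]; exact mul_le_of_le_one_left (by positivity) (inv_le_one_of_one_le₀ hr1)
  have hr4 : r⁻¹ ^ 4 * (r ^ 2 + 1) ≤ 2 * r⁻¹ := by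
    have : r⁻¹ ^ 4 * (r ^ 2 + 1) ≤ r⁻¹ ^ 4 * (2 * r ^ 2) := by gcongr; nlinarith
    have e : r⁻¹ ^ 4 * (2 * r ^ 2) = 2 * r⁻¹ ^ 2 := by field_simp
    linarith
  have t1 : (n : ℝ)⁻¹ * (momentConst m * √((n + 1 : ℕ) : ℝ)) ≤ 2 * momentConst m * r⁻¹ := by
    calc (n : ℝ)⁻¹ * (momentConst m * √((n + 1 : ℕ) : ℝ))
        ≤ (n : ℝ)⁻¹ * (momentConst m * (2 * r)) := by gcongr
      _ = 2 * momentConst m * r⁻¹ := by rw [← hr2]; field_simp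
  have t2 : 2 * (n : ℝ)⁻¹ ^ 2 * (momentConst (2 * m) * √((n + 1 : ℕ) : ℝ)) ^ 2 ≤
      4 * momentConst (2 * m) ^ 2 * r⁻¹ := by
    calc 2 * (n : ℝ)⁻¹ ^ 2 * (momentConst (2 * m) * √((n + 1 : ℕ) : ℝ)) ^ 2
        = 2 * momentConst (2 * m) ^ 2 * (r⁻¹ ^ 4 * (r ^ 2 + 1)) := by
          rw [mul_pow, hs2, ← hr2]; field_simp
      _ ≤ 2 * momentConst (2 * m) ^ 2 * (2 * r⁻¹) := by gcongr
      _ = _ := by ring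
  have t3 : 5 * (n : ℝ)⁻¹ ≤ 5 * r⁻¹ := by
    rw [← hr2, ← inv_pow]; linarith
  have t5 : (2 * tailConst (2 * m) / r) ^ 2 ≤ 4 * tailConst (2 * m) ^ 2 * r⁻¹ := by
    rw [div_eq_mul_inv, mul_pow, mul_pow]
    have := mul_le_mul_of_nonneg_left hinv (by positivity : 0 ≤ 2 ^ 2 * tailConst (2 * m) ^ 2)
    linarith
  have e : errorConst m / 24 / r = 2 * momentConst m * r⁻¹ + 4 * momentConst (2 * m) ^ 2 * r⁻¹ +
      5 * r⁻¹ + 2 * tailConst m / r + 4 * tailConst (2 * m) ^ 2 * r⁻¹ := by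
    rw [errorConst]; field_simp
  rw [e]
  linarith

section Error

variable {Ω : Type*} [MeasurableSpace Ω] {P : Measure Ω} {κ : ℕ → Ω → ℝ}

theorem aemeasurable_zetaCirc (hκ : ∀ l, AEMeasurable (κ l) P) : AEMeasurable (zetaCirc κ) P := by
  have hp := aemeasurable_partialSum hκ
  have : ∀ k, AEMeasurable (zetaTerm κ k) P := fun k => by unfold zetaTerm; fun_prop
  exact AEMeasurable.tsum this

theorem aemeasurable_relativeError (hκ : ∀ l, AEMeasurable (κ l) P) (n : ℕ) :
    AEMeasurable (relativeError κ n) P := by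
  have hp := aemeasurable_partialSum hκ
  have hi := aemeasurable_inversePartialSum hκ
  have hz := aemeasurable_zetaCirc hκ
  have hz' : AEMeasurable (fun ω => |zetaCirc κ ω|) P := hz.norm
  unfold relativeError
  fun_prop

/-- An `Lᵖ` bound for an even exponent, in terms of moments. -/
theorem integrable_pow_and_rpow_integral_le {f : Ω → ℝ} (hf : AEMeasurable f P) {m : ℕ}
    (hm : 1 ≤ m) {c : ℝ} (hc : 0 ≤ c) (h : eLpNorm f (2 * m : ℕ) P ≤ ENNReal.ofReal c) :
    Integrable (fun ω => f ω ^ (2 * m)) P ∧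
      (∫ ω, f ω ^ (2 * m) ∂P) ^ (1 / (2 * (m : ℝ))) ≤ c := by
  have hL : MemLp f (2 * m : ℕ) P :=
    ⟨hf.aestronglyMeasurable, h.trans_lt ENNReal.ofReal_lt_top⟩
  have e : ∀ ω, ‖f ω‖ ^ (2 * m) = f ω ^ (2 * m) := fun ω => by
    rw [Real.norm_eq_abs, Even.pow_abs (even_two_mul m)]
  refine ⟨by simpa only [e] using hL.integrable_norm_pow (by omega), ?_⟩
  have hI := hL.eLpNorm_eq_integral_rpow_norm (by simp; omega) (ENNReal.natCast_ne_top _)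
  rw [ENNReal.toReal_natCast] at hI
  simp only [Real.rpow_natCast, e] at hI
  rw [hI, ENNReal.ofReal_le_ofReal_iff hc] at h
  rw [one_div]
  exact_mod_cast h

variable [IsProbabilityMeasure P]

theorem eLpNorm_errorBound_le (hκ : ∀ l, HasLaw (κ l) (expMeasure 1) P) (hind : iIndepFun κ P)
    {n m : ℕ} (hn : 2 ≤ n) (hm : 1 ≤ m) :
    eLpNorm (errorBound κ n) (2 * m : ℕ) P ≤ ENNReal.ofReal (errorConst m / 24 / √(n : ℝ)) := by
  have hn2 : (2 : ℝ) ≤ n := by exact_mod_cast hn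
  have hYm := aemeasurable_centeredSum (fun l => (hκ l).aemeasurable) (n + 1)
  have hTm := aemeasurable_tailSum hκ hind n
  have hc1 := momentConst_nonneg m
  have hc2 := momentConst_nonneg (2 * m)
  have hd1 := tailConst_nonneg m
  have hd2 := tailConst_nonneg (2 * m)
  have hp : (1 : ℝ≥0∞) ≤ (2 * m : ℕ) := by exact_mod_cast (by omega : 1 ≤ 2 * m)
  have hY1 := eLpNorm_centeredSum_le hκ hind hm (Nat.le_add_left 1 n)
  have hY2 := eLpNorm_centeredSum_le hκ hind (q := 2 * m) (by omega) (Nat.le_add_left 1 n)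
  have hT1 := eLpNorm_tailSum_le hκ hind hm (n := n) (by omega)
  have hT2 := eLpNorm_tailSum_le hκ hind (q := 2 * m) (n := n) (by omega) (by omega)
  have hY1' := eLpNorm_pow_abs_le (f := centeredSum κ (n + 1)) (j := 1) (q := m) (P := P)
    (c := momentConst m * √((n + 1 : ℕ) : ℝ)) (by positivity) one_pos (by rwa [one_mul])
  have hY2' := eLpNorm_pow_abs_le (j := 2) (q := m) (by positivity) two_pos hY2
  have hT2' := eLpNorm_pow_abs_le (j := 2) (q := m) (by positivity) two_pos hT2
  simp only [pow_one] at hY1'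
  have hconst : eLpNorm (fun _ : Ω => 5 * (n : ℝ)⁻¹) (2 * m : ℕ) P ≤
      ENNReal.ofReal (5 * (n : ℝ)⁻¹) := by
    rw [eLpNorm_const _ (by positivity) (NeZero.ne P), measure_univ, ENNReal.one_rpow, mul_one,
      Real.enorm_eq_ofReal (by positivity)]
  have hYm' : AEMeasurable (fun ω => |centeredSum κ (n + 1) ω|) P := hYm.norm
  have hTm' : AEMeasurable (fun ω => |tailSum κ n ω|) P := hTm.norm
  have h1 := eLpNorm_const_mul_le_ofReal (c := (n : ℝ)⁻¹) (by positivity) hY1'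
  have h2 := eLpNorm_const_mul_le_ofReal (c := 2 * (n : ℝ)⁻¹ ^ 2) (by positivity) hY2'
  have h12 := eLpNorm_add_le_ofReal hp (by fun_prop) (by fun_prop) (by positivity) (by positivity)
    h1 h2
  have h123 := eLpNorm_add_le_ofReal hp (by fun_prop) (by fun_prop) (by positivity) (by positivity)
    h12 hconst
  have h1234 := eLpNorm_add_le_ofReal hp (by fun_prop) (by fun_prop) (by positivity) (by positivity)
    h123 hT1
  have h := eLpNorm_add_le_ofReal hp (by fun_prop) (by fun_prop) (by positivity) (by positivity)
    h1234 hT2'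
  refine h.trans (ENNReal.ofReal_le_ofReal ?_)
  exact sum_moment_bounds_le hn hc1 hd1

theorem eLpNorm_relativeError_le (hκ : ∀ l, HasLaw (κ l) (expMeasure 1) P) (hind : iIndepFun κ P)
    {n m : ℕ} (hn : 2 ≤ n) (hm : 1 ≤ m) :
    eLpNorm (relativeError κ n) (2 * m : ℕ) P ≤ ENNReal.ofReal (errorConst m / √(n : ℝ)) := by
  have h := eLpNorm_const_mul_le_ofReal (c := 24) (by norm_num) (eLpNorm_errorBound_le hκ hind hn hm)
  have e : 24 * (errorConst m / 24 / √(n : ℝ)) = errorConst m / √(n : ℝ) := by ring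
  rw [e] at h
  refine le_trans (eLpNorm_mono_ae_real ?_) h
  filter_upwards [ae_partialSum_pos hκ, ae_summable_tailTerm hκ hind] with ω hpos hs
  exact abs_relativeError_le hpos hs hn

end Error

/-! ### Assembly -/

theorem exists_gridSize_eq_natCast {h : ℝ} (hh : h ∈ bandwidths) (hne : h ≠ 1 / 2) :
    ∃ n : ℕ, 2 ≤ n ∧ gridSize h = n := by
  obtain ⟨k, hk, rfl⟩ := hh
  have hk2 : k ≠ 1 := by rintro rfl; simp at hne
  obtain ⟨j, rfl⟩ : ∃ j, k = j + 2 := ⟨k - 2, by omega⟩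
  refine ⟨2 ^ (j + 1), ?_, ?_⟩
  · rw [pow_succ]; have := Nat.one_le_two_pow (n := j); omega
  · rw [gridSize]; push_cast; field_simp; ring

end

theorem mainTheorem5 :
    ∃ (K : ℝ) (C : ℕ → ℝ),
      ∀ (Ω : Type*) [MeasurableSpace Ω] (P : Measure Ω) [IsProbabilityMeasure P]
        (κ : ℕ → Ω → ℝ),
        (∀ l, HasLaw (κ l) (expMeasure 1) P) → iIndepFun κ P →
        (∀ᵐ ω ∂P, Summable fun k : ℕ => zetaTerm κ k ω) ∧
        ∃ ε a b : ℝ → Ω → ℝ,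
          ∀ h ∈ bandwidths, h ≠ 1 / 2 →
            Measurable (ε h) ∧ Measurable (a h) ∧ Measurable (b h) ∧
            (∀ ω, |a h ω| ≤ K * |ε h ω|) ∧ (∀ ω, |b h ω| ≤ K * |ε h ω|) ∧
            (∀ m : ℕ, 1 ≤ m →
              Integrable (fun ω => ε h ω ^ (2 * m)) P ∧
              (∫ ω, ε h ω ^ (2 * m) ∂P) ^ (1 / (2 * (m : ℝ))) ≤
                C m / Real.sqrt (gridSize h)) ∧
            ∀ (Ω' : Type*) [MeasurableSpace Ω'] (P' : Measure Ω') [IsProbabilityMeasure P']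
              (ξ : grid h → Ω' → ℝ),
              (∀ t, HasLaw (ξ t) (gaussianReal 0 1) P') → iIndepFun ξ P' →
              IdentDistrib
                (fun ω' => bayesB h ξ ω' - Real.log (gridSize h)
                  + Real.eulerMascheroniConstant)
                (fun ω => (1 + a h ω) * zetaCirc κ ω
                  + 2 * Real.eulerMascheroniConstant - 1
                  + b h ω * Real.log (gridSize h))
                P' P := by
  refine ⟨1, errorConst, fun Ω _ P _ κ hκ hind => ⟨?_, ?_⟩⟩
  · filter_upwards [ae_summable_tailTerm hκ hind] with ω hω using summable_zetaTerm hω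
  have hκm := fun l => (hκ l).aemeasurable
  have hz := aemeasurable_zetaCirc hκm
  have he := aemeasurable_relativeError hκm
  -- Measurable versions are taken because `κ` is only almost everywhere measurable; the sign in `a`
  -- likewise uses a measurable version of `ζ°`, so that `aζ° = ε|ζ°|` almost surely.
  set ε : ℝ → Ω → ℝ := fun h => (he ⌊gridSize h⌋₊).mk with hε
  have hεm : ∀ h, Measurable (ε h) := fun h => (he _).measurable_mk
  refine ⟨ε, fun h ω => if 0 ≤ hz.mk _ ω then ε h ω else -ε h ω, ε, fun h hh hne => ?_⟩
  obtain ⟨n, hn, hgn⟩ := exists_gridSize_eq_natCast hh hne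
  have hn0 : (n : ℝ) ≠ 0 := by positivity
  have hεn : relativeError κ n =ᵐ[P] ε h := by
    have key : ∀ N, N = n → relativeError κ n =ᵐ[P] (he N).mk := by
      rintro _ rfl
      exact (he _).ae_eq_mk
    exact key _ (by rw [hgn, Nat.floor_natCast])
  refine ⟨hεm h, Measurable.ite (measurableSet_le measurable_const hz.measurable_mk) (hεm h)
    (hεm h).neg, hεm h, fun ω => ?_, fun ω => by rw [one_mul], fun m hm => ?_, ?_⟩
  · simp only
    split_ifs <;> simp
  · rw [hgn]
    refine integrable_pow_and_rpow_integral_le (hεm h).aemeasurable hm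
      (div_nonneg (errorConst_nonneg m) (Real.sqrt_nonneg _)) ?_
    rw [← eLpNorm_congr_ae hεn]
    exact eLpNorm_relativeError_le hκ hind hn hm
  intro Ω' _ P' _ ξ hξ hξind
  have hlaw := hasLaw_sum_one_add_bayesS hξ hξind
  have hcard : Fintype.card (grid h) = n := by
    have := card_grid hh
    rw [hgn] at this
    rw [Fintype.card_coe]
    exact_mod_cast this
  rw [hcard] at hlaw
  have hZ := hasLaw_partialSum_mul_inversePartialSum hκ hind n
  have hid : IdentDistrib (fun ω' => ∑ t, (1 + bayesS (ξ t ω')))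
      (fun ω => partialSum κ (n + 1) ω * inversePartialSum κ n ω) P' P :=
    ⟨hlaw.aemeasurable, hZ.aemeasurable, hlaw.map_eq.trans hZ.map_eq.symm⟩
  -- The `-1` converts the sum of `1 + S` into that of `S`; together with the `γ` contained in
  -- `Z_n/n` it gives the constant `2γ - 1`.
  have hid2 := hid.comp (u := fun w => w / n - 1 - Real.log n + Real.eulerMascheroniConstant)
    (by fun_prop)
  rw [hgn]
  have hleft : (fun ω' => bayesB h ξ ω' - Real.log n + Real.eulerMascheroniConstant) =
      (fun w => w / n - 1 - Real.log n + Real.eulerMascheroniConstant) ∘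
        fun ω' => ∑ t, (1 + bayesS (ξ t ω')) := by
    ext ω'
    simp only [Function.comp_apply, bayesB, hgn, Finset.sum_add_distrib, Finset.sum_const,
      Finset.card_univ, hcard, nsmul_eq_mul, mul_one]
    field_simp
    ring
  have hright : (fun w => w / n - 1 - Real.log n + Real.eulerMascheroniConstant) ∘
        (fun ω => partialSum κ (n + 1) ω * inversePartialSum κ n ω) =ᵐ[P]
      fun ω => (1 + if 0 ≤ hz.mk _ ω then ε h ω else -ε h ω) * zetaCirc κ ω +
        2 * Real.eulerMascheroniConstant - 1 + ε h ω * Real.log n := by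
    filter_upwards [hεn, hz.ae_eq_mk] with ω hω hzω
    rw [← hω, ← hzω]
    have hL := half_le_log hn
    have hD : 0 < |zetaCirc κ ω| + Real.log n := by linarith [abs_nonneg (zetaCirc κ ω)]
    have h1 : relativeError κ n ω * (|zetaCirc κ ω| + Real.log n) =
        partialSum κ (n + 1) ω * inversePartialSum κ n ω / n - Real.log n -
          Real.eulerMascheroniConstant - zetaCirc κ ω := div_mul_cancel₀ _ hD.ne'
    simp only [Function.comp_apply]
    split_ifs with hz0
    · rw [abs_of_nonneg hz0] at h1; linarith
    · rw [abs_of_neg (not_le.1 hz0)] at h1; linarith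
  rw [hleft]
  exact hid2.trans (IdentDistrib.of_ae_eq hid2.aemeasurable_snd hright)
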